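/- Let $\lambda=(\lambda_1>\lambda_2>\dots>\lambda_\ell>0)$ be a partition with distinct parts, with shifted Young diagram $[\lambda]^*=\{(i,j): 1\le i\le \ell,\ i\le j\le \lambda_i+i-1\}$. The hook $H^*_{ij}$ of $(i,j)\in[\lambda]^*$ consists of the squares of $[\lambda]^*$ that lie in row $i$ weakly to the right of $(i,j)$, or in column $j$ weakly below $(i,j)$, or in row $j+1$; put $h^*_{ij}=|H^*_{ij}|$ for $(i,j)\in[\lambda]^*$ and $h^*_{ij}=1$ for $(i,j)\notin[\lambda]^*$. Let $\mathcal C^*[\lambda]$ be the set of shifted corners, i.e. the squares $(i,j)\in[\lambda]^*$ with $(i+1,j),(i,j+1)\notin[\lambda]^*$. Write $[M]=\{1,\dots,M\}$; empty products are $1$. For $I\subseteq[M]$ and $k\in I$ put $$S_M(I,k)=\prod_{i\in[M]:\ i\notin I\text{ or }i>k}(h^*_{i,r-1}-1)\prod_{i\in[M]:\ i\notin I\text{ or }i<k}(h^*_{is}-1).$$ For $(r,s)\in\mathcal C^*[\lambda]$ and $m\geq 1$ let $H_{\lambda,r,s,m}$ be - if $1\le r\le m$: $$\prod_{i=1}^{r-1}(h^*_{i,r-1}-1)\prod_{j=r}^{m-1}(h^*_{rj}-1)\prod_{i=2}^{r-1}h^*_{is};$$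 - if $r=m+1$: $$\sum_{I\subseteq[m],\ \min I=1,\ k\in I}S_m(I,k)+\prod_{i=2}^{r-1}h^*_{i,r-1}\prod_{i=1}^{r-1}(h^*_{is}-1);$$ - if $r\ge m+2$: $$\sum_{I\subseteq[m],\ \min I=1,\ k\in I}S_m(I,k)+\sum_{I\subseteq[m+1],\ \min I=1,\ \max I=m+1,\ k\in I}S_{m+1}(I,k)$$ $$+(h^*_{m+1,r-1}-1)\prod_{i=2}^{m}h^*_{i,r-1}\prod_{i=1}^{m}(h^*_{is}-1)+(h^*_{m+1,s}-1)\prod_{i=2}^{m}h^*_{is}\prod_{i=1}^{m}(h^*_{i,r-1}-1).$$ Then for every $m$ with $1\le m\le\lambda_1$, $$\prod_{(i,j)\in[\lambda]^*\setminus\mathcal C^*[\lambda]}(h^*_{ij}-1)=\sum_{(r,s)\in\mathcal C^*[\lambda]}H_{\lambda,r,s,m}\prod_{\substack{(i,j)\in[\lambda]^*\setminus\mathcal C^*[\lambda]\\ i\ne r,\ j\ne r-1,s}}(h^*_{ij}-1)\prod_{i=m+2}^{r-1}h^*_{is}\prod_{j=\max\{r,m+1\}}^{s-1}h^*_{rj}\prod_{i=m+2}^{r-1}h^*_{i,r-1}.$$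 Moreover, for $m=1$ the summand for each corner $(r,s)$ equals $$\bigl(h^*_{1s}h^*_{2,r-1}+(h^*_{1,r-1}-1)(h^*_{2s}-1)\bigr)\prod_{\substack{(i,j)\in[\lambda]^*\setminus\mathcal C^*[\lambda]\\ i\ne r,\ j\ne r-1,s}}(h^*_{ij}-1)\prod_{i=3}^{r-1}h^*_{is}\prod_{j=\max\{r,2\}}^{s-1}h^*_{rj}\prod_{i=3}^{r-1}h^*_{i,r-1}.$$ -/

import Mathlib

open Finset

namespace ShiftedHook

/-- The `i`-th part `λ_i` (`i = 1, 2, …`) of a partition, the parts being listed in decreasing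
order; it is `0` when `i` exceeds the number of parts. -/
def part {n : ℕ} (p : n.Partition) (i : ℕ) : ℕ :=
  (p.parts.sort (fun a b => b ≤ a)).getD (i - 1) 0

/-- The number of parts `ℓ(λ)`. -/
def len {n : ℕ} (p : n.Partition) : ℕ := p.parts.card

/-- The shifted Young diagram `[λ]* = {(i, j) : 1 ≤ i ≤ ℓ, i ≤ j ≤ λ_i + i - 1}`. -/
def diagram {n : ℕ} (p : n.Partition) : Finset (ℕ × ℕ) :=
  (Icc 1 (len p)).biUnion fun i => (Icc i (part p i + i - 1)).image fun j => (i, j)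

theorem mem_diagram {n : ℕ} (p : n.Partition) (z : ℕ × ℕ) :
    z ∈ diagram p ↔ 1 ≤ z.1 ∧ z.1 ≤ len p ∧ z.1 ≤ z.2 ∧ z.2 ≤ part p z.1 + z.1 - 1 := by
  obtain ⟨a, b⟩ := z
  simp only [diagram, mem_biUnion, mem_Icc, mem_image, Prod.mk.injEq]
  constructor
  · rintro ⟨i, hi, j, hj, rfl, rfl⟩
    exact ⟨hi.1, hi.2, hj.1, hj.2⟩
  · rintro ⟨h1, h2, h3, h4⟩
    exact ⟨a, ⟨h1, h2⟩, b, ⟨h3, h4⟩, rfl, rfl⟩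

/-- The shifted corners: squares `(i, j)` of `[λ]*` with `(i + 1, j), (i, j + 1) ∉ [λ]*`. -/
def corners {n : ℕ} (p : n.Partition) : Finset (ℕ × ℕ) :=
  (diagram p).filter fun z => (z.1 + 1, z.2) ∉ diagram p ∧ (z.1, z.2 + 1) ∉ diagram p

/-- The shifted hook of `(i, j)`: the squares of `[λ]*` in row `i` weakly to the right of `(i, j)`,
in column `j` weakly below `(i, j)`, and in row `j + 1`. -/
def hook {n : ℕ} (p : n.Partition) (i j : ℕ) : Finset (ℕ × ℕ) :=
  (diagram p).filter fun w => (w.1 = i ∧ j ≤ w.2) ∨ (w.2 = j ∧ i ≤ w.1) ∨ w.1 = j + 1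

/-- The shifted hook length `h*_{ij}`, with the convention `h*_{ij} = 1` if `(i, j) ∉ [λ]*`.
It is integer-valued so that `h*_{ij} - 1` is an honest difference. -/
def h {n : ℕ} (p : n.Partition) (i j : ℕ) : ℤ :=
  if (i, j) ∈ diagram p then ((hook p i j).card : ℤ) else 1

/-- The contribution of the snake given by `I ⊆ [M]` and `k ∈ I`:
`∏_{i ∉ I or i > k} (h*_{i,r-1} - 1) ∏_{i ∉ I or i < k} (h*_{i,s} - 1)`, with `i` ranging
over `[M]`. -/
def snakeTerm {n : ℕ} (p : n.Partition) (r s M : ℕ) (I : Finset ℕ) (k : ℕ) : ℤ :=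
  (∏ i ∈ (Icc 1 M).filter (fun i => i ∉ I ∨ k < i), (h p i (r - 1) - 1)) *
    ∏ i ∈ (Icc 1 M).filter (fun i => i ∉ I ∨ i < k), (h p i s - 1)

/-- The sum of `snakeTerm` over all `I ⊆ [m]` with `min I = 1` and all `k ∈ I`. -/
def snakeSum {n : ℕ} (p : n.Partition) (r s m : ℕ) : ℤ :=
  ∑ I ∈ (Icc 1 m).powerset.filter (fun I => I.min = ((1 : ℕ) : WithTop ℕ)),
    ∑ k ∈ I, snakeTerm p r s m I k

/-- The sum of `snakeTerm` over all `I ⊆ [m + 1]` with `min I = 1`, `max I = m + 1` and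
all `k ∈ I`. -/
def snakeSumFull {n : ℕ} (p : n.Partition) (r s m : ℕ) : ℤ :=
  ∑ I ∈ (Icc 1 (m + 1)).powerset.filter
      (fun I => I.min = ((1 : ℕ) : WithTop ℕ) ∧ I.max = ((m + 1 : ℕ) : WithBot ℕ)),
    ∑ k ∈ I, snakeTerm p r s (m + 1) I k

/-- The weight `H_{λ,r,s,m}`. -/
def H {n : ℕ} (p : n.Partition) (r s m : ℕ) : ℤ :=
  if r ≤ m then
    (∏ i ∈ Icc 1 (r - 1), (h p i (r - 1) - 1)) * (∏ j ∈ Icc r (m - 1), (h p r j - 1)) *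
      ∏ i ∈ Icc 2 (r - 1), h p i s
  else if r = m + 1 then
    snakeSum p r s m +
      (∏ i ∈ Icc 2 (r - 1), h p i (r - 1)) * ∏ i ∈ Icc 1 (r - 1), (h p i s - 1)
  else
    snakeSum p r s m + snakeSumFull p r s m +
      (h p (m + 1) (r - 1) - 1) * (∏ i ∈ Icc 2 m, h p i (r - 1)) *
        (∏ i ∈ Icc 1 m, (h p i s - 1)) +
      (h p (m + 1) s - 1) * (∏ i ∈ Icc 2 m, h p i s) * ∏ i ∈ Icc 1 m, (h p i (r - 1) - 1)

/-- The product of `h*_{ij} - 1` over the squares `(i, j) ∈ [λ]*` that are not corners and satisfy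
`i ≠ r`, `j ≠ r - 1` and `j ≠ s`. -/
def unshadedProd {n : ℕ} (p : n.Partition) (r s : ℕ) : ℤ :=
  ∏ z ∈ (diagram p \ corners p).filter (fun z => z.1 ≠ r ∧ z.2 ≠ r - 1 ∧ z.2 ≠ s),
    (h p z.1 z.2 - 1)

end ShiftedHook

/-! Write `a_i` for the parts. A corner in row `r` lies in column `s = a_r + r - 1`, and for `i < r`
the hooks above it and in column `r - 1` are explicit: `h_{is} = a_i - a_r + 1` and `h_{i,r-1} = a_i
+ a_r`. Along row `r`, products of `h` telescope against products of `h - 1` (`prod_row_of_len_le`,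
`prod_row_of_le_len`). So each summand is the left-hand product times a rational function of the
parts, `cornerRatio` (`fullWeight_eq`), and it remains to see that these ratios add up to 1
(`sum_cornerRatio`).

That is Lagrange interpolation: for a monic polynomial of degree one less than the number of nodes,
the leading coefficient 1 is the sum of the values at the nodes divided by products of node
differences. If `m < ℓ`, the nodes are `a_1, ..., a_ℓ` and `1 - a_{m+1}, ..., 1 - a_ℓ`, and the
roots are `a_j + 1` (`2 ≤ j ≤ ℓ`), `-a_j` (`m + 2 ≤ j ≤ ℓ`) and `0`. If `m ≥ ℓ`, the nodes are `a_1,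
..., a_q` with `q` the length of column `m`, and the roots are `a_j + 1` (`2 ≤ j ≤ q`). Rows without
a corner contribute nothing: there `a_r = a_{r+1} + 1`, so `a_r`, and `1 - a_r` if it is a node, are
roots.

When `r > m`, the weight must produce the terms of both nodes `a_r` and `1 - a_r`. The difference
`h_{i,r-1} - h_{is} = 2 a_r - 1` is independent of `i` and equals the distance between these nodes;
multiplied by it, the snake sum becomes a difference of two products (`mul_snakeTotal`), one for
each node. -/

namespace ShiftedHook

variable {n : ℕ} (p : n.Partition)

/-! ### Parts, column lengths and the hook length formula. -/

theorem part_eq_getElem {i : ℕ} (hi : 1 ≤ i) (hl : i ≤ len p) :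
    part p i = (p.parts.sort (fun a b => b ≤ a))[i - 1]'(by
      rw [Multiset.length_sort]; unfold len at hl; omega) := by
  unfold part
  rw [List.getD_eq_getElem]

theorem part_eq_zero {i : ℕ} (hl : len p < i) : part p i = 0 := by
  unfold part
  apply List.getD_eq_default
  rw [Multiset.length_sort]; unfold len at hl; omega

theorem part_pos {i : ℕ} (hi : 1 ≤ i) (hl : i ≤ len p) : 0 < part p i := by
  rw [part_eq_getElem p hi hl]
  apply p.parts_pos
  rw [← Multiset.mem_sort (r := fun a b => b ≤ a)]
  exact List.getElem_mem _

theorem part_lt_part (hp : p.parts.Nodup) {i j : ℕ} (hi : 1 ≤ i) (hij : i < j) (hj : j ≤ len p) :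
    part p j < part p i := by
  rw [part_eq_getElem p hi (by omega), part_eq_getElem p (by omega) hj]
  have h1 : (p.parts.sort (fun a b => b ≤ a)).Pairwise (fun a b => b ≤ a) :=
    Multiset.pairwise_sort _ _
  have h2 : (p.parts.sort (fun a b => b ≤ a)).Nodup := by
    rw [← Multiset.coe_nodup, Multiset.sort_eq]; exact hp
  refine lt_of_le_of_ne (List.pairwise_iff_getElem.mp h1 _ _ _ _ (by omega)) fun h => ?_
  have := (List.Nodup.getElem_inj_iff h2).mp h
  omega

/-- Strict decrease of the parts keeps the right ends of the rows from moving right on the way down;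
this is what makes columns gap-free. -/
theorem part_add_le (hp : p.parts.Nodup) {i j : ℕ} (hi : 1 ≤ i) (hij : i ≤ j) (hj : j ≤ len p) :
    part p j + j ≤ part p i + i := by
  induction j, hij using Nat.le_induction with
  | base => exact le_rfl
  | succ k hk ih =>
    have := part_lt_part p hp (i := k) (j := k + 1) (by omega) (by omega) hj
    have := ih (by omega)
    omega

/-- The number of squares in column `j` of the shifted diagram. -/
def colLen (j : ℕ) : ℕ := ((Icc 1 (len p)).filter fun i => (i, j) ∈ diagram p).card

theorem mem_diagram_of_le (hp : p.parts.Nodup) {i k j : ℕ} (hi : 1 ≤ i) (hik : i ≤ k)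
    (hk : (k, j) ∈ diagram p) : (i, j) ∈ diagram p := by
  rw [mem_diagram] at hk ⊢
  dsimp only at hk ⊢
  have := part_add_le p hp hi hik (by omega)
  omega

theorem mem_diagram_iff_le_colLen (hp : p.parts.Nodup) (i j : ℕ) :
    (i, j) ∈ diagram p ↔ 1 ≤ i ∧ i ≤ colLen p j := by
  have key : ∃ q, ((Icc 1 (len p)).filter fun i => (i, j) ∈ diagram p) = Icc 1 q := by
    by_cases he : ((Icc 1 (len p)).filter fun i => (i, j) ∈ diagram p).Nonempty
    · refine ⟨max' _ he, Finset.ext fun k => ⟨fun hk => mem_Icc.mpr ⟨?_, le_max' _ _ hk⟩, fun hk => ?_⟩⟩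
      · exact (mem_Icc.mp (mem_filter.mp hk).1).1
      · have h1 := mem_filter.mp (max'_mem _ he)
        have h2 := mem_Icc.mp h1.1
        have h3 := mem_Icc.mp hk
        exact mem_filter.mpr ⟨mem_Icc.mpr ⟨h3.1, h3.2.trans h2.2⟩,
          mem_diagram_of_le p hp h3.1 h3.2 h1.2⟩
    · exact ⟨0, by rw [not_nonempty_iff_eq_empty.mp he]; rfl⟩
  obtain ⟨q, hq⟩ := key
  have hc : colLen p j = q := by rw [colLen, hq, Nat.card_Icc]; omega
  have hm := Finset.ext_iff.mp hq i
  rw [mem_filter, mem_Icc, mem_Icc] at hm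
  rw [hc, ← hm]
  refine ⟨fun h => ⟨?_, h⟩, fun h => h.2⟩
  have := (mem_diagram p _).mp h
  exact ⟨this.1, this.2.1⟩

theorem colLen_eq_of_iff (hp : p.parts.Nodup) {j q : ℕ}
    (h : ∀ i, 1 ≤ i → ((i, j) ∈ diagram p ↔ i ≤ q)) : colLen p j = q := by
  have h1 := (mem_diagram_iff_le_colLen p hp (colLen p j) j)
  have h2 := (mem_diagram_iff_le_colLen p hp q j)
  have h3 := h (colLen p j)
  have h4 := h q
  by_cases h5 : 1 ≤ colLen p j <;> by_cases h6 : 1 ≤ q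
  · have := h3 h5; have := h4 h6; simp_all; omega
  · have := h3 h5; simp_all
  · have := h4 h6; simp_all
  · omega

theorem colLen_le_self (j : ℕ) (hp : p.parts.Nodup) : colLen p j ≤ j := by
  by_contra hc
  have := (mem_diagram_iff_le_colLen p hp (colLen p j) j).mpr ⟨by omega, le_rfl⟩
  rw [mem_diagram] at this
  dsimp only at this
  omega

theorem colLen_le_len (hp : p.parts.Nodup) (m : ℕ) : colLen p m ≤ len p := by
  by_contra hc
  have := (mem_diagram_iff_le_colLen p hp (colLen p m) m).mpr ⟨by omega, le_rfl⟩
  rw [mem_diagram] at this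
  dsimp only at this
  omega

theorem hook_eq (hp : p.parts.Nodup) {i j : ℕ} (hij : (i, j) ∈ diagram p) :
    hook p i j = ((Icc j (part p i + i - 1)).image fun b => (i, b)) ∪
      (((Icc (i + 1) (colLen p j)).image fun c => (c, j)) ∪
        ((Icc (j + 1) (part p (j + 1) + j)).image fun b => (j + 1, b))) := by
  have hij' := (mem_diagram p _).mp hij
  dsimp only at hij'
  ext ⟨c, b⟩
  rw [hook, mem_filter]
  simp only [mem_union, mem_image, mem_Icc, Prod.mk.injEq]
  constructor
  · rintro ⟨h1, h2⟩
    have h1' := (mem_diagram p _).mp h1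
    dsimp only at h1'
    rcases h2 with ⟨rfl, h⟩ | ⟨rfl, h⟩ | rfl
    · exact Or.inl ⟨b, ⟨h, h1'.2.2.2⟩, rfl, rfl⟩
    · rcases h.eq_or_lt with rfl | h
      · exact Or.inl ⟨b, ⟨le_rfl, h1'.2.2.2⟩, rfl, rfl⟩
      · exact Or.inr (Or.inl ⟨c, ⟨h, ((mem_diagram_iff_le_colLen p hp _ _).mp h1).2⟩, rfl, rfl⟩)
    · exact Or.inr (Or.inr ⟨b, ⟨h1'.2.2.1, by omega⟩, rfl, rfl⟩)
  · rintro (⟨x, h, rfl, rfl⟩ | ⟨x, h, rfl, rfl⟩ | ⟨x, h, rfl, rfl⟩)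
    · exact ⟨(mem_diagram p _).mpr ⟨hij'.1, hij'.2.1, by dsimp only; omega, h.2⟩,
        Or.inl ⟨rfl, h.1⟩⟩
    · exact ⟨(mem_diagram_iff_le_colLen p hp _ _).mpr ⟨by omega, h.2⟩,
        Or.inr (Or.inl ⟨rfl, by omega⟩)⟩
    · refine ⟨(mem_diagram p _).mpr ⟨by dsimp only; omega, ?_, h.1, by dsimp only; omega⟩,
        Or.inr (Or.inr rfl)⟩
      by_contra hc
      have := part_eq_zero p (i := j + 1) (by simpa using hc)
      omega

/-- The arm has `λ_i + i - j` squares, the leg `colLen p j - i`, and row `j + 1` is taken whole; the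
`i` cancels. -/
theorem h_eq (hp : p.parts.Nodup) {i j : ℕ} (hij : (i, j) ∈ diagram p) :
    h p i j = part p i + colLen p j - j + part p (j + 1) := by
  have hij' := (mem_diagram p _).mp hij
  have hc := (mem_diagram_iff_le_colLen p hp _ _).mp hij
  have hcj := colLen_le_self p j hp
  dsimp only at hij'
  rw [h, if_pos hij, hook_eq p hp hij, card_union_of_disjoint, card_union_of_disjoint,
    card_image_of_injective, card_image_of_injective, card_image_of_injective, Nat.card_Icc,
    Nat.card_Icc, Nat.card_Icc]
  · omega
  · intro x y hxy; simpa using hxy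
  · intro x y hxy; simpa using hxy
  · intro x y hxy; simpa using hxy
  · rw [disjoint_left]
    simp only [mem_image, mem_Icc]
    rintro _ ⟨x, h, rfl⟩ ⟨y, h', h''⟩
    rw [Prod.mk.injEq] at h''
    omega
  · rw [disjoint_left]
    simp only [mem_union, mem_image, mem_Icc]
    rintro _ ⟨x, h, rfl⟩ (⟨y, h', h''⟩ | ⟨y, h', h''⟩) <;>
    · rw [Prod.mk.injEq] at h''
      omega

theorem colLen_eq_self (hp : p.parts.Nodup) {j : ℕ} (hj : j ≤ len p) : colLen p j = j := by
  refine colLen_eq_of_iff p hp fun i hi => ⟨fun h => ((mem_diagram p _).mp h).2.2.1, fun h => ?_⟩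
  have := part_add_le p hp hi h hj
  have := part_pos p (i := j) (by omega) hj
  rw [mem_diagram]
  dsimp only
  omega

/-! ### Corners and the hooks in their rows and columns. -/

/-- The rows that end in a shifted corner. -/
def cornerRows : Finset ℕ :=
  (Icc 1 (len p)).filter fun r => r = len p ∨ part p (r + 1) + 1 < part p r

theorem mem_cornerRows {r : ℕ} : r ∈ cornerRows p ↔
    1 ≤ r ∧ r ≤ len p ∧ (r = len p ∨ part p (r + 1) + 1 < part p r) := by
  rw [cornerRows, mem_filter, mem_Icc, and_assoc]

theorem mem_corners_iff (hp : p.parts.Nodup) (r s : ℕ) :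
    (r, s) ∈ corners p ↔ r ∈ cornerRows p ∧ s = part p r + r - 1 := by
  rw [mem_cornerRows, corners, mem_filter, mem_diagram, mem_diagram, mem_diagram]
  dsimp only
  constructor
  · rintro ⟨h1, h2, h3⟩
    by_cases hr : r = len p
    · omega
    · have := part_lt_part p hp (i := r) (j := r + 1) h1.1 (by omega) (by omega)
      have := part_pos p (i := r + 1) (by omega) (by omega)
      omega
  · rintro ⟨⟨h1, h2, h3⟩, rfl⟩
    have := part_pos p h1 h2
    omega

theorem corners_eq_image (hp : p.parts.Nodup) :
    corners p = (cornerRows p).image fun r => (r, part p r + r - 1) := by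
  ext ⟨r, s⟩
  rw [mem_corners_iff p hp, mem_image]
  simp only [Prod.mk.injEq]
  constructor
  · rintro ⟨h1, h2⟩
    exact ⟨r, h1, rfl, h2.symm⟩
  · rintro ⟨r, h1, rfl, h2⟩
    exact ⟨h1, h2.symm⟩

/-- Row `s + 1` is therefore empty, so hooks in a corner column have no third arm. -/
theorem len_le_of_cornerRow (hp : p.parts.Nodup) {r : ℕ} (hr : r ∈ cornerRows p) :
    len p ≤ part p r + r - 1 := by
  rw [mem_cornerRows] at hr
  have := part_add_le p hp hr.1 hr.2.1 le_rfl
  have := part_pos p (i := len p) (by omega) le_rfl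
  omega

theorem colLen_corner (hp : p.parts.Nodup) {r : ℕ} (hr : r ∈ cornerRows p) :
    colLen p (part p r + r - 1) = r := by
  have hl := len_le_of_cornerRow p hp hr
  rw [mem_cornerRows] at hr
  refine colLen_eq_of_iff p hp fun i hi => ⟨fun h => ?_, fun h => ?_⟩
  · rw [mem_diagram] at h
    dsimp only at h
    by_contra hc
    have := part_add_le p hp (i := r + 1) (j := i) (by omega) (by omega) (by omega)
    omega
  · have := part_add_le p hp hi h hr.2.1
    rw [mem_diagram]
    dsimp only
    omega

theorem h_left (hp : p.parts.Nodup) {i r : ℕ} (hi : 1 ≤ i) (hir : i < r) (hr : r ≤ len p) :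
    h p i (r - 1) = part p i + part p r := by
  have hc := colLen_eq_self p hp (j := r - 1) (by omega)
  rw [h_eq p hp ((mem_diagram_iff_le_colLen p hp _ _).mpr (by omega)), hc,
    Nat.sub_add_cancel (by omega)]
  ring

theorem h_above_corner (hp : p.parts.Nodup) {i r : ℕ} (hi : 1 ≤ i) (hir : i ≤ r)
    (hr : r ∈ cornerRows p) :
    h p i (part p r + r - 1) = part p i - part p r + 1 := by
  have hc := colLen_corner p hp hr
  have hl := len_le_of_cornerRow p hp hr
  rw [h_eq p hp ((mem_diagram_iff_le_colLen p hp _ _).mpr (by omega)), hc,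
    part_eq_zero p (i := part p r + r - 1 + 1) (by omega)]
  rw [mem_cornerRows] at hr
  push_cast [show 1 ≤ part p r + r by omega]
  ring

theorem h_row (hp : p.parts.Nodup) {r j : ℕ} (hr1 : 1 ≤ r) (hr : r ≤ len p) (hrj : r ≤ j)
    (hj : j ≤ part p r + r - 1) :
    h p r j = part p r + colLen p j - j + part p (j + 1) :=
  h_eq p hp ((mem_diagram p _).mpr ⟨hr1, hr, hrj, hj⟩)

theorem h_row_of_le_len (hp : p.parts.Nodup) {r j : ℕ} (hr1 : 1 ≤ r)
    (hrj : r ≤ j) (hj : j ≤ len p) :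
    h p r j = part p r + part p (j + 1) := by
  have hc := colLen_eq_self p hp hj
  rw [h_eq p hp ((mem_diagram_iff_le_colLen p hp _ _).mpr (by omega)), hc]
  ring

/-! ### Telescoping of hook products along a corner row. -/

/-- Telescoping of `∏ (c + i) / (c + i - 1)`, cleared of denominators so that no factor need be
nonzero. -/
theorem prod_add_mul_eq (c : ℤ) {q' q : ℕ} (hq : q' ≤ q) :
    (∏ i ∈ Ico (q' + 1) (q + 1), (c + i)) * (c + q') =
      (c + q) * ∏ i ∈ Ico (q' + 1) (q + 1), (c + i - 1) := by
  induction q, hq using Nat.le_induction with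
  | base => simp
  | succ k hk ih =>
    rw [prod_Ico_succ_top (show q' + 1 ≤ k + 1 by omega),
      prod_Ico_succ_top (show q' + 1 ≤ k + 1 by omega)]
    push_cast
    linear_combination (c + (k + 1)) * ih

/-- The bound on `j` matters: along the staircase, for `j < ℓ`, columns grow by one. -/
theorem colLen_succ_le (hp : p.parts.Nodup) {j : ℕ} (hj : len p ≤ j) :
    colLen p (j + 1) ≤ colLen p j := by
  by_contra hc
  have h1 := (mem_diagram_iff_le_colLen p hp (colLen p (j + 1)) (j + 1)).mpr ⟨by omega, le_rfl⟩
  have h2 : (colLen p (j + 1), j) ∈ diagram p := by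
    rw [mem_diagram] at h1 ⊢
    dsimp only at h1 ⊢
    omega
  have := (mem_diagram_iff_le_colLen p hp _ _).mp h2
  omega

/-- Such a row meets column `j` but not column `j + 1`, so it ends exactly in column `j`. -/
theorem part_of_colLen_lt (hp : p.parts.Nodup) {i j : ℕ} (hi : colLen p (j + 1) < i)
    (hi' : i ≤ colLen p j) : (part p i : ℤ) = j + 1 - i := by
  have h1 := (mem_diagram_iff_le_colLen p hp i j).mpr ⟨by omega, hi'⟩
  have h2 := mt (mem_diagram_iff_le_colLen p hp i (j + 1)).mp (by omega)
  rw [mem_diagram] at h1 h2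
  dsimp only at h1 h2
  omega

/-- The hook lengths in a corner row, to the right of column `m ≥ ℓ`. -/
theorem prod_row_of_len_le (hp : p.parts.Nodup) {r m : ℕ} (hr : r ∈ cornerRows p)
    (hm : len p ≤ m) (hms : m ≤ part p r + r - 1) :
    (∏ j ∈ Ico (m + 1) (part p r + r - 1 + 1), h p r j) *
        ∏ i ∈ Ico (r + 1) (colLen p m + 1), ((part p r : ℤ) - part p i) =
      (∏ j ∈ Ico m (part p r + r - 1), (h p r j - 1)) *
        ∏ i ∈ Ico (r + 1) (colLen p m + 1), ((part p r : ℤ) - part p i - 1) := by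
  have hr' := (mem_cornerRows p).mp hr
  -- Induction leftwards from the corner column, whose length is `r`. Passing from `m + 1` to `m`
  -- brings in the rows ending in column `m`; their parts are consecutive integers, so their factors
  -- telescope.
  generalize hd : part p r + r - 1 - m = d
  induction d generalizing m with
  | zero =>
    obtain rfl : m = part p r + r - 1 := by omega
    rw [colLen_corner p hp hr]
    simp
  | succ d ih =>
    have h0 := ih (m := m + 1) (by omega) (by omega) (by omega)
    have hq : r ≤ colLen p (m + 1) :=
      ((mem_diagram_iff_le_colLen p hp _ _).mp
        ((mem_diagram p (r, m + 1)).mpr ⟨hr'.1, hr'.2.1, by dsimp only; omega,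
          by dsimp only; omega⟩)).2
    have hqq := colLen_succ_le p hp hm
    have e1 : ∏ i ∈ Ico (colLen p (m + 1) + 1) (colLen p m + 1), ((part p r : ℤ) - part p i) =
        ∏ i ∈ Ico (colLen p (m + 1) + 1) (colLen p m + 1), ((part p r : ℤ) - m - 1 + i) := by
      refine prod_congr rfl fun i hi => ?_
      rw [mem_Ico] at hi
      rw [part_of_colLen_lt p hp (i := i) (j := m) (by omega) (by omega)]
      ring
    have e2 : ∏ i ∈ Ico (colLen p (m + 1) + 1) (colLen p m + 1), ((part p r : ℤ) - part p i - 1) =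
        ∏ i ∈ Ico (colLen p (m + 1) + 1) (colLen p m + 1), ((part p r : ℤ) - m - 1 + i - 1) := by
      refine prod_congr rfl fun i hi => ?_
      rw [mem_Ico] at hi
      rw [part_of_colLen_lt p hp (i := i) (j := m) (by omega) (by omega)]
      ring
    have e3 := prod_add_mul_eq ((part p r : ℤ) - m - 1) hqq
    have e4 := h_row p hp hr'.1 hr'.2.1 (j := m) (by omega) (by omega)
    have e5 := h_row p hp hr'.1 hr'.2.1 (j := m + 1) (by omega) (by omega)
    rw [part_eq_zero p (i := m + 1) (by omega)] at e4
    rw [part_eq_zero p (i := m + 1 + 1) (by omega)] at e5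
    push_cast at e4 e5
    rw [← prod_Ico_consecutive _ (show r + 1 ≤ colLen p (m + 1) + 1 by omega)
        (show colLen p (m + 1) + 1 ≤ colLen p m + 1 by omega),
      ← prod_Ico_consecutive _ (show r + 1 ≤ colLen p (m + 1) + 1 by omega)
        (show colLen p (m + 1) + 1 ≤ colLen p m + 1 by omega), e1, e2,
      prod_eq_prod_Ico_succ_bot (show m + 1 < part p r + r - 1 + 1 by omega),
      prod_eq_prod_Ico_succ_bot (show m < part p r + r - 1 by omega), e4, e5]
    generalize (∏ j ∈ Ico (m + 1) (part p r + r - 1), (h p r j - 1)) = A at *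
    generalize (∏ j ∈ Ico (m + 1 + 1) (part p r + r - 1 + 1), h p r j) = B at *
    generalize ∏ i ∈ Ico (r + 1) (colLen p (m + 1) + 1), ((part p r : ℤ) - part p i) = T at *
    generalize ∏ i ∈ Ico (r + 1) (colLen p (m + 1) + 1), ((part p r : ℤ) - part p i - 1) = T' at *
    linear_combination (A * T') * e3 +
      ((part p r : ℤ) + colLen p (m + 1) - (m + 1)) *
      (∏ i ∈ Ico (colLen p (m + 1) + 1) (colLen p m + 1), ((part p r : ℤ) - m - 1 + i)) * h0

/-- The hook lengths in a corner row, to the right of column `m ≤ ℓ`. -/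
theorem prod_row_of_le_len (hp : p.parts.Nodup) {r m : ℕ} (hr : r ∈ cornerRows p)
    (hrm : r ≤ m) (hm : m ≤ len p) :
    (∏ j ∈ Ico (m + 1) (part p r + r - 1 + 1), h p r j) *
        (∏ i ∈ Ico (m + 1) (len p + 1), ((part p r : ℤ) + part p i - 1)) *
        ∏ i ∈ Ico (r + 1) (len p + 1), ((part p r : ℤ) - part p i) =
      (∏ j ∈ Ico m (part p r + r - 1), (h p r j - 1)) *
        (∏ i ∈ Ico (m + 2) (len p + 2), ((part p r : ℤ) + part p i)) *
        ∏ i ∈ Ico (r + 1) (len p + 1), ((part p r : ℤ) - part p i - 1) := by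
  have hr' := (mem_cornerRows p).mp hr
  have hl := len_le_of_cornerRow p hp hr
  generalize hd : len p - m = d
  induction d generalizing m with
  | zero =>
    obtain rfl : m = len p := by omega
    have := prod_row_of_len_le p hp hr le_rfl hl
    rw [colLen_eq_self p hp le_rfl] at this
    simpa using this
  | succ d ih =>
    have h0 := ih (m := m + 1) (by omega) (by omega) (by omega)
    have e4 := h_row_of_le_len p hp hr'.1 (j := m) (by omega) (by omega)
    have e5 := h_row_of_le_len p hp hr'.1 (j := m + 1) (by omega) (by omega)
    rw [prod_eq_prod_Ico_succ_bot (show m + 1 < part p r + r - 1 + 1 by omega),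
      prod_eq_prod_Ico_succ_bot (show m < part p r + r - 1 by omega),
      prod_eq_prod_Ico_succ_bot (show m + 1 < len p + 1 by omega),
      prod_eq_prod_Ico_succ_bot (show m + 2 < len p + 2 by omega), e4, e5]
    -- Here `h_{rj} = λ_r + λ_{j+1}`, so each hook matches a part with index one higher; hence the
    -- product of sums runs up to `ℓ + 1`, where the part is 0.
    linear_combination (((part p r : ℤ) + part p (m + 1 + 1)) *
      ((part p r : ℤ) + part p (m + 1) - 1)) * h0

theorem Icc_sub_one_eq_Ico {a : ℕ} (ha : 1 ≤ a) (b : ℕ) : Icc a (b - 1) = Ico a b := by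
  ext i
  rw [mem_Icc, mem_Ico]
  omega

/-! ### Snake sums for two abstract sequences of hooks. -/

/-- Generic version of `snakeTerm`. -/
def snakeWeight (x y : ℕ → ℤ) (M : ℕ) (I : Finset ℕ) (k : ℕ) : ℤ :=
  (∏ i ∈ (Icc 1 M).filter (fun i => i ∉ I ∨ k < i), (x i - 1)) *
    ∏ i ∈ (Icc 1 M).filter (fun i => i ∉ I ∨ i < k), (y i - 1)

theorem filter_Icc_succ (m : ℕ) (P : ℕ → Prop) [DecidablePred P] (f : ℕ → ℤ) :
    ∏ i ∈ (Icc 1 (m + 1)).filter P, f i =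
      (∏ i ∈ (Icc 1 m).filter P, f i) * if P (m + 1) then f (m + 1) else 1 := by
  rw [prod_filter, prod_filter, prod_Icc_succ_top (by omega)]

theorem snakeWeight_succ_of_notMem (x y : ℕ → ℤ) {m k : ℕ} {I : Finset ℕ} (hI : m + 1 ∉ I) :
    snakeWeight x y (m + 1) I k = (x (m + 1) - 1) * (y (m + 1) - 1) * snakeWeight x y m I k := by
  rw [snakeWeight, snakeWeight, filter_Icc_succ, filter_Icc_succ, if_pos (Or.inl hI),
    if_pos (Or.inl hI)]
  ring

theorem filter_insert_congr (m : ℕ) (I : Finset ℕ) (Q : ℕ → Prop) [DecidablePred Q] :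
    (Icc 1 m).filter (fun i => i ∉ insert (m + 1) I ∨ Q i) =
      (Icc 1 m).filter (fun i => i ∉ I ∨ Q i) := by
  refine filter_congr fun i hi => ?_
  rw [mem_Icc] at hi
  rw [mem_insert, not_or, and_iff_right (by omega)]

theorem snakeWeight_succ_insert (x y : ℕ → ℤ) {m k : ℕ} {I : Finset ℕ} (hk : k ≤ m) :
    snakeWeight x y (m + 1) (insert (m + 1) I) k = (x (m + 1) - 1) * snakeWeight x y m I k := by
  rw [snakeWeight, snakeWeight, filter_Icc_succ, filter_Icc_succ, if_pos (Or.inr (by omega)),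
    if_neg (by simp; omega), filter_insert_congr m, filter_insert_congr m]
  ring

theorem snakeWeight_succ_insert_self (x y : ℕ → ℤ) {m : ℕ} {I : Finset ℕ} :
    snakeWeight x y (m + 1) (insert (m + 1) I) (m + 1) =
      (∏ i ∈ Icc 1 m \ I, (x i - 1)) * ∏ i ∈ Icc 1 m, (y i - 1) := by
  rw [snakeWeight, filter_Icc_succ, filter_Icc_succ, if_neg (by simp),
    if_neg (by simp), filter_insert_congr m, filter_insert_congr m, mul_one, mul_one]
  congr 1
  · refine prod_congr (Finset.ext fun i => ?_) fun _ _ => rfl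
    simp only [mem_filter, mem_sdiff, mem_Icc]
    constructor <;> rintro ⟨h1, h2⟩ <;> refine ⟨h1, ?_⟩
    · exact h2.resolve_right (by omega)
    · exact Or.inl h2
  · refine prod_congr (Finset.ext fun i => ?_) fun _ _ => rfl
    simp only [mem_filter, mem_Icc]
    exact ⟨fun h => h.1, fun h => ⟨h, Or.inr (by omega)⟩⟩

/-- The sum of `snakeWeight` over `I ⊆ [m]` containing `1` and over `k ∈ I`. -/
def snakeTotal (x y : ℕ → ℤ) (m : ℕ) : ℤ :=
  ∑ I ∈ (Icc 1 m).powerset with 1 ∈ I, ∑ k ∈ I, snakeWeight x y m I k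

/-- The sum of `snakeWeight` over `I ⊆ [m + 1]` containing `1` and `m + 1` and over `k ∈ I`. -/
def snakeTotalFull (x y : ℕ → ℤ) (m : ℕ) : ℤ :=
  ∑ I ∈ (Icc 1 (m + 1)).powerset with 1 ∈ I ∧ m + 1 ∈ I, ∑ k ∈ I, snakeWeight x y (m + 1) I k

theorem sum_powerset_Icc_succ (m : ℕ) (f : Finset ℕ → ℤ) :
    ∑ I ∈ (Icc 1 (m + 1)).powerset, f I =
      ∑ I ∈ (Icc 1 m).powerset, f I + ∑ I ∈ (Icc 1 m).powerset, f (insert (m + 1) I) := by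
  rw [← insert_Icc_right_eq_Icc_add_one (by omega), sum_powerset_insert (by simp)]

/-- Expansion of `∏ ((x i - 1) + 1)` over `2 ≤ i ≤ m`: apart from 1, `I` records where the summand 1
is chosen. -/
theorem sum_prod_sdiff (x : ℕ → ℤ) {m : ℕ} (hm : 1 ≤ m) :
    ∑ I ∈ (Icc 1 m).powerset with 1 ∈ I, ∏ i ∈ Icc 1 m \ I, (x i - 1) = ∏ i ∈ Ico 2 (m + 1), x i := by
  induction m, hm using Nat.le_induction with
  | base => simp [sum_filter, show ({1} : Finset ℕ).powerset = {∅, {1}} from rfl]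
  | succ m hm ih =>
    rw [prod_Ico_succ_top (by omega), ← ih, sum_filter, sum_powerset_Icc_succ, ← sum_add_distrib,
      sum_filter, sum_mul]
    refine sum_congr rfl fun I hI => ?_
    rw [mem_powerset] at hI
    have hmI : m + 1 ∉ I := fun h => by have := mem_Icc.mp (hI h); omega
    have e1 : Icc 1 (m + 1) \ I = insert (m + 1) (Icc 1 m \ I) := by
      rw [← insert_Icc_right_eq_Icc_add_one (by omega), insert_sdiff_of_notMem _ hmI]
    have e2 : Icc 1 (m + 1) \ insert (m + 1) I = Icc 1 m \ I := by
      rw [← insert_Icc_right_eq_Icc_add_one (by omega), insert_sdiff_insert,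
        sdiff_insert_of_notMem (by simp)]
    rw [e1, e2, prod_insert (by simp)]
    by_cases h1 : 1 ∈ I
    · rw [if_pos h1, if_pos h1, if_pos (mem_insert_of_mem h1)]
      ring
    · rw [if_neg h1, if_neg h1, if_neg (by rw [mem_insert]; rintro (h | h); · omega
                                           · exact h1 h)]
      ring

/-- If `k ≤ m`, row `m + 1` only contributes `x (m + 1) - 1`. If `k = m + 1`, all `y`-factors with
`i ≤ m` survive and the sum over `I` is `sum_prod_sdiff`. -/
theorem snakeTotalFull_eq (x y : ℕ → ℤ) {m : ℕ} (hm : 1 ≤ m) :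
    snakeTotalFull x y m = (x (m + 1) - 1) * snakeTotal x y m +
      (∏ i ∈ Ico 2 (m + 1), x i) * ∏ i ∈ Icc 1 m, (y i - 1) := by
  rw [← sum_prod_sdiff x hm, snakeTotalFull, sum_filter, sum_powerset_Icc_succ, snakeTotal,
    sum_filter, sum_filter, mul_sum, sum_mul, ← sum_add_distrib, ← sum_add_distrib]
  refine sum_congr rfl fun I hI => ?_
  rw [mem_powerset] at hI
  have hmI : m + 1 ∉ I := fun h => by have := mem_Icc.mp (hI h); omega
  rw [if_neg (fun h => hmI h.2), zero_add]
  by_cases h1 : 1 ∈ I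
  · rw [if_pos h1, if_pos h1, if_pos ⟨mem_insert_of_mem h1, mem_insert_self _ _⟩, sum_insert hmI,
      snakeWeight_succ_insert_self, mul_sum, add_comm]
    congr 1
    exact sum_congr rfl fun k hk => snakeWeight_succ_insert x y (mem_Icc.mp (hI hk)).2
  · rw [if_neg h1, if_neg h1, if_neg]
    · ring
    · rintro ⟨h, -⟩
      rw [mem_insert] at h
      rcases h with h | h
      · omega
      · exact h1 h

theorem snakeTotal_succ (x y : ℕ → ℤ) {m : ℕ} :
    snakeTotal x y (m + 1) =
      (x (m + 1) - 1) * (y (m + 1) - 1) * snakeTotal x y m + snakeTotalFull x y m := by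
  rw [snakeTotal, sum_filter, sum_powerset_Icc_succ, snakeTotal, snakeTotalFull, sum_filter,
    sum_filter, sum_powerset_Icc_succ, mul_sum, ← sum_add_distrib, ← sum_add_distrib,
    ← sum_add_distrib]
  refine sum_congr rfl fun I hI => ?_
  rw [mem_powerset] at hI
  have hmI : m + 1 ∉ I := fun h => by have := mem_Icc.mp (hI h); omega
  rw [if_neg (c := 1 ∈ I ∧ m + 1 ∈ I) (fun h => hmI h.2), zero_add]
  congr 1
  · split_ifs with h1
    · rw [mul_sum]
      exact sum_congr rfl fun k _ => snakeWeight_succ_of_notMem x y hmI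
    · ring
  · refine if_congr ?_ rfl rfl
    exact ⟨fun h => ⟨h, mem_insert_self _ _⟩, fun h => h.1⟩

theorem snakeTotal_one (x y : ℕ → ℤ) : snakeTotal x y 1 = 1 := by
  simp [snakeTotal, sum_filter, show ({1} : Finset ℕ).powerset = {∅, {1}} from rfl, snakeWeight,
    Finset.filter_singleton]

/-- Closed form of the snake sum when `x i - y i` does not depend on `i`. -/
theorem mul_snakeTotal (x y : ℕ → ℤ) (c : ℤ) {m : ℕ} (hm : 1 ≤ m)
    (hc : ∀ i, 1 ≤ i → i ≤ m → x i - y i = c) :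
    c * snakeTotal x y m = (x 1 - 1) * ∏ i ∈ Ico 2 (m + 1), ((x i - 1) * y i) -
      (y 1 - 1) * ∏ i ∈ Ico 2 (m + 1), (x i * (y i - 1)) := by
  induction m, hm using Nat.le_induction with
  | base => simp [snakeTotal_one, ← hc 1 le_rfl le_rfl]
  | succ m hm ih =>
    have h0 := ih fun i h1 h2 => hc i h1 (by omega)
    have h1 : ∏ i ∈ Icc 1 m, (y i - 1) = (y 1 - 1) * ∏ i ∈ Ico 2 (m + 1), (y i - 1) := by
      rw [← prod_eq_prod_Ico_succ_bot (show 1 < m + 1 by omega) fun i => y i - 1,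
        ← Icc_sub_one_eq_Ico le_rfl, Nat.add_sub_cancel]
    have h2 := hc (m + 1) (by omega) le_rfl
    rw [snakeTotal_succ, snakeTotalFull_eq x y hm,
      prod_Ico_succ_top (show 2 ≤ m + 1 by omega) fun i => (x i - 1) * y i,
      prod_Ico_succ_top (show 2 ≤ m + 1 by omega) fun i => x i * (y i - 1), h1]
    have h3 : ∏ i ∈ Ico 2 (m + 1), (x i * (y i - 1)) =
      (∏ i ∈ Ico 2 (m + 1), x i) * ∏ i ∈ Ico 2 (m + 1), (y i - 1) := prod_mul_distrib
    rw [h3] at h0 ⊢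
    -- The recursion multiplies the old sum by `(x - 1) y`; the second product needs the factor `x
    -- (y - 1) = (x - 1) y - (x - y)`, and `x - y = c`.
    linear_combination ((x (m + 1) - 1) * y (m + 1)) * h0 -
      ((y 1 - 1) * (∏ i ∈ Ico 2 (m + 1), x i) * ∏ i ∈ Ico 2 (m + 1), (y i - 1)) * h2

theorem min_eq_one_iff {m : ℕ} {I : Finset ℕ} (hI : I ⊆ Icc 1 m) :
    I.min = ((1 : ℕ) : WithTop ℕ) ↔ 1 ∈ I := by
  refine ⟨fun h => mem_of_min h, fun h => le_antisymm (min_le h) ?_⟩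
  exact Finset.le_min fun a ha => WithTop.coe_le_coe.mpr (mem_Icc.mp (hI ha)).1

theorem max_eq_iff {m : ℕ} {I : Finset ℕ} (hI : I ⊆ Icc 1 m) :
    I.max = (m : WithBot ℕ) ↔ m ∈ I := by
  refine ⟨fun h => mem_of_max h, fun h => le_antisymm ?_ (le_max h)⟩
  exact Finset.max_le fun a ha => WithBot.coe_le_coe.mpr (mem_Icc.mp (hI ha)).2

theorem snakeSum_eq (r s m : ℕ) :
    snakeSum p r s m = snakeTotal (fun i => h p i (r - 1)) (fun i => h p i s) m := by
  rw [snakeSum, snakeTotal]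
  refine sum_congr (filter_congr fun I hI => ?_) fun _ _ => rfl
  exact min_eq_one_iff (mem_powerset.mp hI)

theorem snakeSumFull_eq (r s m : ℕ) :
    snakeSumFull p r s m = snakeTotalFull (fun i => h p i (r - 1)) (fun i => h p i s) m := by
  rw [snakeSumFull, snakeTotalFull]
  refine sum_congr (filter_congr fun I hI => ?_) fun _ _ => rfl
  exact and_congr (min_eq_one_iff (mem_powerset.mp hI)) (max_eq_iff (mem_powerset.mp hI))

/-! ### Lagrange interpolation identities. -/

open Polynomial in
-- Both sides are the leading coefficient of the monic polynomial with roots `w k`, interpolated at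
-- the nodes `v i`.
theorem sum_prod_sub_div_prod_erase {ι κ : Type*} [DecidableEq ι] (s : Finset ι) (v : ι → ℚ)
    (hv : Set.InjOn v s) (t : Finset κ) (w : κ → ℚ) (hst : s.card = t.card + 1) :
    ∑ i ∈ s, (∏ k ∈ t, (v i - w k)) / ∏ j ∈ s.erase i, (v i - v j) = 1 := by
  have h := Lagrange.leadingCoeff_eq_sum hv (P := Lagrange.nodal t w)
    (by rw [Lagrange.degree_nodal, hst]; norm_num)
  rw [(Lagrange.nodal_monic (s := t) (v := w)).leadingCoeff] at h
  rw [h]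
  exact sum_congr rfl fun i _ => by rw [Lagrange.eval_nodal]

theorem erase_Ico {a b r : ℕ} (ha : a ≤ r) (hb : r ≤ b) :
    (Ico a (b + 1)).erase r = Ico a r ∪ Ico (r + 1) (b + 1) := by
  ext i
  rw [mem_erase, mem_union, mem_Ico, mem_Ico, mem_Ico]
  omega

theorem prod_erase_Ico {a b r : ℕ} (ha : a ≤ r) (hb : r ≤ b) (f : ℕ → ℚ) :
    ∏ i ∈ (Ico a (b + 1)).erase r, f i = (∏ i ∈ Ico a r, f i) * ∏ i ∈ Ico (r + 1) (b + 1), f i := by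
  rw [erase_Ico ha hb, prod_union]
  rw [disjoint_left]
  intro i h1 h2
  rw [mem_Ico] at h1 h2
  omega

theorem prod_Ico_eq_mul_mul {a b r : ℕ} (ha : a ≤ r) (hb : r ≤ b) (f : ℕ → ℚ) :
    ∏ i ∈ Ico a (b + 1), f i =
      (∏ i ∈ Ico a r, f i) * f r * ∏ i ∈ Ico (r + 1) (b + 1), f i := by
  rw [← prod_Ico_consecutive f ha (show r ≤ b + 1 by omega),
    prod_eq_prod_Ico_succ_bot (show r < b + 1 by omega) f]
  ring

section Lagrange

variable (a : ℕ → ℚ)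

theorem prod_sub_sub_one_div_prod_erase {r q : ℕ} (hr : 1 ≤ r) (hq : r ≤ q) :
    (∏ j ∈ Ico 2 (q + 1), (a r - a j - 1)) / ∏ i ∈ (Ico 1 (q + 1)).erase r, (a r - a i) =
      ((∏ j ∈ Ico 2 r, (a j - a r + 1)) / ∏ i ∈ Ico 1 r, (a i - a r)) *
      ((∏ i ∈ Ico (r + 1) (q + 1), (a r - a i - 1)) /
        ∏ i ∈ Ico (r + 1) (q + 1), (a r - a i)) := by
  have hD : ∏ i ∈ Ico 1 r, (a r - a i) = (-1) ^ (r - 1) * ∏ i ∈ Ico 1 r, (a i - a r) := by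
    rw [← Nat.card_Ico 1 r, ← prod_neg]
    exact prod_congr rfl fun i _ => by ring
  have hN : ∏ j ∈ Ico 2 (q + 1), (a r - a j - 1) = (-1) ^ (r - 1) *
      ((∏ j ∈ Ico 2 r, (a j - a r + 1)) * ∏ i ∈ Ico (r + 1) (q + 1), (a r - a i - 1)) := by
    rcases hr.eq_or_lt with rfl | hr2
    · simp
    · have h1 : ∏ i ∈ Ico 2 r, (a r - a i - 1) =
          (-1) ^ (r - 2) * ∏ i ∈ Ico 2 r, (a i - a r + 1) := by
        rw [← Nat.card_Ico 2 r, ← prod_neg]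
        exact prod_congr rfl fun i _ => by ring
      -- The factor `j = r` is `-1`; with the `r - 2` reversed differences it gives the sign of the
      -- denominator.
      rw [prod_Ico_eq_mul_mul (show 2 ≤ r by omega) hq, h1,
        show r - 1 = r - 2 + 1 by omega, pow_succ]
      ring
  rw [prod_erase_Ico hr hq, hD, hN, mul_assoc, mul_div_mul_left _ _ (by simp), mul_div_mul_comm]

/-- The contribution of row `r` to the Lagrange identity for unshifted hooks. -/
def plainTerm (q r : ℕ) : ℚ :=
  ((∏ j ∈ Ico 2 r, (a j - a r + 1)) / ∏ i ∈ Ico 1 r, (a i - a r)) *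
    ((∏ i ∈ Ico (r + 1) (q + 1), (a r - a i - 1)) / ∏ i ∈ Ico (r + 1) (q + 1), (a r - a i))

theorem sum_plainTerm {q : ℕ} (hq : 1 ≤ q) (ha : Set.InjOn a (Ico 1 (q + 1))) :
    ∑ r ∈ Ico 1 (q + 1), plainTerm a q r = 1 := by
  rw [← sum_prod_sub_div_prod_erase (Ico 1 (q + 1)) a ha (Ico 2 (q + 1)) (fun j => a j + 1)
    (by rw [Nat.card_Ico, Nat.card_Ico]; omega)]
  refine sum_congr rfl fun r hr => ?_
  rw [mem_Ico] at hr
  rw [plainTerm, ← prod_sub_sub_one_div_prod_erase a hr.1 (by omega)]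
  congr 1
  exact prod_congr rfl fun i _ => by ring

/-- The contribution of the node `a r` to the Lagrange identity for shifted hooks. -/
def leftTerm (l m r : ℕ) : ℚ :=
  plainTerm a l r * (a r * (∏ j ∈ Ico (m + 2) (l + 1), (a r + a j)) /
    ∏ j ∈ Ico (m + 1) (l + 1), (a r + a j - 1))

/-- The contribution of the node `1 - a r` to the Lagrange identity for shifted hooks. -/
def rightTerm (l m r : ℕ) : ℚ :=
  (a r - 1) * (∏ j ∈ Ico 2 (l + 1), (a r + a j)) * (∏ j ∈ Ico (m + 2) (l + 1), (a j - a r + 1)) /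
    ((∏ j ∈ Ico 1 (l + 1), (a r + a j - 1)) * ∏ j ∈ (Ico (m + 1) (l + 1)).erase r, (a j - a r))

theorem erase_disjSum_inl {α β : Type*} [DecidableEq α] [DecidableEq β] (s : Finset α)
    (t : Finset β) (x : α) : (s.disjSum t).erase (Sum.inl x) = (s.erase x).disjSum t := by
  ext (y | y) <;> simp

theorem erase_disjSum_inr {α β : Type*} [DecidableEq α] [DecidableEq β] (s : Finset α)
    (t : Finset β) (x : β) : (s.disjSum t).erase (Sum.inr x) = s.disjSum (t.erase x) := by
  ext (y | y) <;> simp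

/-- Interpolation at the nodes `a i` and their reflections `1 - a i` (`i > m`). The two families are
disjoint, since `a ≥ 1` makes the first positive and the second nonpositive. -/
theorem sum_leftTerm_add_sum_rightTerm {l m : ℕ} (hml : m < l)
    (ha : Set.InjOn a (Ico 1 (l + 1))) (ha1 : ∀ i ∈ Ico 1 (l + 1), 1 ≤ a i) :
    ∑ r ∈ Ico 1 (l + 1), leftTerm a l m r + ∑ r ∈ Ico (m + 1) (l + 1), rightTerm a l m r = 1 := by
  have hv : Set.InjOn (Sum.elim a fun i => 1 - a i)
      ((Ico 1 (l + 1)).disjSum (Ico (m + 1) (l + 1)) : Finset (ℕ ⊕ ℕ)) := by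
    have hsub : ∀ i ∈ Ico (m + 1) (l + 1), i ∈ Ico 1 (l + 1) := fun i hi => by
      rw [mem_Ico] at hi ⊢; omega
    rintro (i | i) hi (j | j) hj hij <;>
      simp only [mem_coe, inl_mem_disjSum, inr_mem_disjSum, Sum.elim_inl, Sum.elim_inr]
        at hi hj hij
    · rw [ha hi hj hij]
    · linarith [ha1 i hi, ha1 j (hsub j hj)]
    · linarith [ha1 j hj, ha1 i (hsub i hi)]
    · rw [ha (hsub i hi) (hsub j hj) (by linarith)]
  have key := sum_prod_sub_div_prod_erase _ _ hv
    (((Ico 2 (l + 1)).disjSum (Ico (m + 2) (l + 1))).disjSum (range 1))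
    (Sum.elim (Sum.elim (fun i => a i + 1) fun i => -a i) fun _ => 0)
    (by rw [card_disjSum, card_disjSum, card_disjSum, Nat.card_Ico, Nat.card_Ico, Nat.card_Ico,
          Nat.card_Ico, card_range]; omega)
  rw [sum_disjSum] at key
  rw [← key]
  congr 1
  · refine sum_congr rfl fun r hr => ?_
    rw [mem_Ico] at hr
    rw [erase_disjSum_inl, prod_disjSum, prod_disjSum, prod_disjSum, prod_range_one, leftTerm,
      plainTerm, ← prod_sub_sub_one_div_prod_erase a hr.1 (by omega), div_mul_div_comm]
    simp only [Sum.elim_inl, Sum.elim_inr]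
    congr 1
    · rw [mul_comm (a r), ← mul_assoc, sub_zero]
      congr 2
      · exact prod_congr rfl fun i _ => by ring
      · exact prod_congr rfl fun i _ => by ring
    · congr 1
      exact prod_congr rfl fun i _ => by ring
  · refine sum_congr rfl fun r hr => ?_
    rw [mem_Ico] at hr
    rw [erase_disjSum_inr, prod_disjSum, prod_disjSum, prod_disjSum, prod_range_one, rightTerm]
    simp only [Sum.elim_inl, Sum.elim_inr]
    have h1 : ∏ i ∈ Ico 2 (l + 1), (1 - a r - (a i + 1)) =
        (-1) ^ (l - 1) * ∏ i ∈ Ico 2 (l + 1), (a r + a i) := by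
      rw [show l - 1 = (Ico 2 (l + 1)).card by rw [Nat.card_Ico]; omega, ← prod_neg]
      exact prod_congr rfl fun i _ => by ring
    -- There is one factor more than in `h1`; the extra sign turns the factor `1 - a r` from the
    -- root 0 into `a r - 1`.
    have h2 : ∏ i ∈ Ico 1 (l + 1), (1 - a r - a i) =
        (-1) ^ (l - 1) * -∏ i ∈ Ico 1 (l + 1), (a r + a i - 1) := by
      rw [mul_neg, ← neg_mul, ← mul_neg_one, ← pow_succ,
        show l - 1 + 1 = (Ico 1 (l + 1)).card by rw [Nat.card_Ico]; omega, ← prod_neg]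
      exact prod_congr rfl fun i _ => by ring
    have h3 : ∏ i ∈ Ico (m + 2) (l + 1), (1 - a r - -a i) =
        ∏ i ∈ Ico (m + 2) (l + 1), (a i - a r + 1) :=
      prod_congr rfl fun i _ => by ring
    have h4 : ∏ i ∈ (Ico (m + 1) (l + 1)).erase r, (1 - a r - (1 - a i)) =
        ∏ i ∈ (Ico (m + 1) (l + 1)).erase r, (a i - a r) :=
      prod_congr rfl fun i _ => by ring
    rw [h1, h2, h3, h4, ← mul_div_mul_left ((a r - 1) * _ * _) _
      (show -(-1 : ℚ) ^ (l - 1) ≠ 0 by simp)]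
    congr 1 <;> ring

end Lagrange

/-! ### Splitting off the squares in row `r` and columns `r - 1` and `s`. -/

theorem filter_shaded_eq (hp : p.parts.Nodup) {r s : ℕ} (hc : (r, s) ∈ corners p) :
    (diagram p \ corners p).filter (fun z => ¬(z.1 ≠ r ∧ z.2 ≠ r - 1 ∧ z.2 ≠ s)) =
      ((Ico 1 r).image fun i => (i, r - 1)) ∪
        (((Ico 1 r).image fun i => (i, s)) ∪ ((Ico r s).image fun j => (r, j))) := by
  obtain ⟨hr, hs⟩ := (mem_corners_iff p hp r s).mp hc
  have hr' := (mem_cornerRows p).mp hr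
  have hpos := part_pos p hr'.1 hr'.2.1
  have hcol : ∀ i, (i, s) ∈ diagram p ↔ 1 ≤ i ∧ i ≤ r := fun i => by
    rw [mem_diagram_iff_le_colLen p hp, hs, colLen_corner p hp hr]
  ext ⟨i, j⟩
  simp only [mem_filter, mem_union, mem_image, mem_sdiff, mem_Ico, Prod.mk.injEq]
  constructor
  · rintro ⟨⟨h1, h2⟩, h3⟩
    have h1' := (mem_diagram p _).mp h1
    dsimp only at h1'
    by_cases hj : j = r - 1
    · exact Or.inl ⟨i, by omega, rfl, hj.symm⟩
    · by_cases hi : i = r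
      · subst hi
        have : j ≠ s := fun h => h2 (h ▸ hc)
        exact Or.inr (Or.inr ⟨j, by omega, rfl, rfl⟩)
      · have hjs : j = s := by
          by_contra hjs
          exact h3 ⟨hi, hj, hjs⟩
        subst hjs
        have := (hcol i).mp h1
        exact Or.inr (Or.inl ⟨i, by omega, rfl, rfl⟩)
  · rintro (⟨k, hk, rfl, rfl⟩ | ⟨k, hk, rfl, rfl⟩ | ⟨k, hk, rfl, rfl⟩)
    · have := part_add_le p hp hk.1 hk.2.le hr'.2.1
      refine ⟨⟨(mem_diagram p _).mpr (by dsimp only; omega), fun h => ?_⟩, fun h => h.2.1 rfl⟩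
      exact (mem_filter.mp h).2.2 ((mem_diagram p _).mpr (by dsimp only; omega))
    · refine ⟨⟨(hcol k).mpr (by omega), fun h => ?_⟩, fun h => h.2.2 rfl⟩
      exact (mem_filter.mp h).2.1 ((hcol _).mpr (by omega))
    · refine ⟨⟨(mem_diagram p _).mpr (by dsimp only; omega), fun h => ?_⟩, fun h => h.1 rfl⟩
      exact (mem_filter.mp h).2.2 ((mem_diagram p _).mpr (by dsimp only; omega))

theorem prod_eq_unshadedProd_mul (hp : p.parts.Nodup) {r s : ℕ} (hc : (r, s) ∈ corners p) :
    ∏ z ∈ diagram p \ corners p, (h p z.1 z.2 - 1) = unshadedProd p r s *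
      ((∏ i ∈ Ico 1 r, (h p i (r - 1) - 1)) * (∏ i ∈ Ico 1 r, (h p i s - 1)) *
        ∏ j ∈ Ico r s, (h p r j - 1)) := by
  obtain ⟨hr, hs⟩ := (mem_corners_iff p hp r s).mp hc
  have hr' := (mem_cornerRows p).mp hr
  have hpos := part_pos p hr'.1 hr'.2.1
  rw [← prod_filter_mul_prod_filter_not _ (fun z => z.1 ≠ r ∧ z.2 ≠ r - 1 ∧ z.2 ≠ s),
    filter_shaded_eq p hp hc, prod_union, prod_union, prod_image, prod_image, prod_image,
    ← mul_assoc (∏ i ∈ Ico 1 r, _)]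
  · rfl
  · intro x _ y _ hxy; simpa using hxy
  · intro x _ y _ hxy; simpa using hxy
  · intro x _ y _ hxy; simpa using hxy
  · rw [disjoint_left]
    simp only [mem_image, mem_Ico]
    rintro _ ⟨x, h, rfl⟩ ⟨y, h', h''⟩
    rw [Prod.mk.injEq] at h''
    omega
  · rw [disjoint_left]
    simp only [mem_union, mem_image, mem_Ico]
    rintro _ ⟨x, h, rfl⟩ (⟨y, h', h''⟩ | ⟨y, h', h''⟩) <;>
    · rw [Prod.mk.injEq] at h''
      omega

theorem h_corner (hp : p.parts.Nodup) {r : ℕ} (hr : r ∈ cornerRows p) :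
    h p r (part p r + r - 1) = 1 := by
  rw [h_above_corner p hp ((mem_cornerRows p).mp hr).1 le_rfl hr]
  ring

theorem prod_row_succ (hp : p.parts.Nodup) {r : ℕ} (hr : r ∈ cornerRows p) (k : ℕ) :
    ∏ j ∈ Ico k (part p r + r - 1 + 1), h p r j = ∏ j ∈ Ico k (part p r + r - 1), h p r j := by
  by_cases hk : k ≤ part p r + r - 1
  · rw [prod_Ico_succ_top hk, h_corner p hp hr, mul_one]
  · rw [Ico_eq_empty (by omega), Ico_eq_empty (by omega)]

/-- The hook lengths in a whole corner row. -/
theorem prod_whole_row (hp : p.parts.Nodup) {r : ℕ} (hr : r ∈ cornerRows p) :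
    (∏ j ∈ Ico r (part p r + r - 1), h p r j) *
        (∏ i ∈ Ico (r + 1) (len p + 1), ((part p r : ℤ) + part p i - 1)) *
        ∏ i ∈ Ico (r + 1) (len p + 1), ((part p r : ℤ) - part p i) =
      (∏ j ∈ Ico r (part p r + r - 1), (h p r j - 1)) *
        ((part p r : ℤ) * ∏ i ∈ Ico (r + 1) (len p + 1), ((part p r : ℤ) + part p i)) *
        ∏ i ∈ Ico (r + 1) (len p + 1), ((part p r : ℤ) - part p i - 1) := by
  have hr' := (mem_cornerRows p).mp hr
  have hpos := part_pos p hr'.1 hr'.2.1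
  have h0 := prod_row_of_le_len p hp hr le_rfl hr'.2.1
  have h1 : (part p r : ℤ) * ∏ i ∈ Ico (r + 1) (len p + 1), ((part p r : ℤ) + part p i) =
      ((part p r : ℤ) + part p (r + 1)) *
        ∏ i ∈ Ico (r + 2) (len p + 2), ((part p r : ℤ) + part p i) := by
    rw [← prod_eq_prod_Ico_succ_bot (show r + 1 < len p + 2 by omega)
      (fun i => (part p r : ℤ) + part p i), 
      prod_Ico_succ_top (show r + 1 ≤ len p + 1 by omega), part_eq_zero p (i := len p + 1) (by omega)]
    push_cast
    ring
  rw [← prod_row_succ p hp hr, prod_eq_prod_Ico_succ_bot (by omega), h1,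
    h_row_of_le_len p hp hr'.1 le_rfl hr'.2.1]
  linear_combination ((part p r : ℤ) + part p (r + 1)) * h0

/-! ### Closed forms of the weights. -/

theorem weight_of_le {r s m : ℕ} (hr : 1 ≤ r) (hm : r ≤ m) : H p r s m =
    (∏ i ∈ Ico 1 r, (h p i (r - 1) - 1)) * (∏ j ∈ Ico r m, (h p r j - 1)) *
      ∏ i ∈ Ico 2 r, h p i s := by
  rw [H, if_pos hm, Icc_sub_one_eq_Ico le_rfl, Icc_sub_one_eq_Ico hr, Icc_sub_one_eq_Ico (by omega)]

theorem mul_snakeSum (hp : p.parts.Nodup) {r m : ℕ} (hr : r ∈ cornerRows p) (hm : 1 ≤ m)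
    (hmr : m < r) : (2 * (part p r : ℤ) - 1) * snakeSum p r (part p r + r - 1) m =
      (part p 1 + part p r - 1) *
          ((∏ i ∈ Ico 2 (m + 1), ((part p i : ℤ) + part p r - 1)) *
            ∏ i ∈ Ico 2 (m + 1), ((part p i : ℤ) - part p r + 1)) -
        (part p 1 - part p r) * ((∏ i ∈ Ico 2 (m + 1), ((part p i : ℤ) + part p r)) *
            ∏ i ∈ Ico 2 (m + 1), ((part p i : ℤ) - part p r)) := by
  have hr' := (mem_cornerRows p).mp hr
  have hx : ∀ i, 1 ≤ i → i ≤ m → h p i (r - 1) = part p i + part p r := fun i h1 h2 =>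
    h_left p hp h1 (by omega) hr'.2.1
  have hy : ∀ i, 1 ≤ i → i ≤ m → h p i (part p r + r - 1) = part p i - part p r + 1 :=
    fun i h1 h2 => h_above_corner p hp h1 (by omega) hr
  rw [snakeSum_eq, mul_snakeTotal _ _ _ hm fun i h1 h2 => by rw [hx i h1 h2, hy i h1 h2]; ring,
    ← prod_mul_distrib, ← prod_mul_distrib, hx 1 le_rfl hm, hy 1 le_rfl hm, add_sub_cancel_right]
  congr 2 <;>
  · refine prod_congr rfl fun i hi => ?_
    rw [mem_Ico] at hi
    rw [hx i (by omega) (by omega), hy i (by omega) (by omega)] <;> ring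

theorem mul_weight_succ (hp : p.parts.Nodup) {m : ℕ} (hm : 1 ≤ m) (hr : m + 1 ∈ cornerRows p) :
    (2 * (part p (m + 1) : ℤ) - 1) * H p (m + 1) (part p (m + 1) + (m + 1) - 1) m =
      (part p 1 + part p (m + 1) - 1) *
          ((∏ i ∈ Ico 2 (m + 1), ((part p i : ℤ) + part p (m + 1) - 1)) *
            ∏ i ∈ Ico 2 (m + 1), ((part p i : ℤ) - part p (m + 1) + 1)) +
        (2 * (part p (m + 1) : ℤ) - 2) * (part p 1 - part p (m + 1)) *
          ((∏ i ∈ Ico 2 (m + 1), ((part p i : ℤ) + part p (m + 1))) *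
            ∏ i ∈ Ico 2 (m + 1), ((part p i : ℤ) - part p (m + 1))) := by
  have hr' := (mem_cornerRows p).mp hr
  have h0 := mul_snakeSum p hp hr hm (by omega)
  have h1 : ∏ i ∈ Ico 2 (m + 1), h p i (m + 1 - 1) =
      ∏ i ∈ Ico 2 (m + 1), ((part p i : ℤ) + part p (m + 1)) :=
    prod_congr rfl fun i hi => by
      rw [mem_Ico] at hi
      exact h_left p hp (by omega) (by omega) hr'.2.1
  have h2 : ∏ i ∈ Ico 1 (m + 1), (h p i (part p (m + 1) + (m + 1) - 1) - 1) =
      (part p 1 - part p (m + 1)) * ∏ i ∈ Ico 2 (m + 1), ((part p i : ℤ) - part p (m + 1)) := by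
    rw [← prod_eq_prod_Ico_succ_bot (show 1 < m + 1 by omega)
      fun i => (part p i : ℤ) - part p (m + 1)]
    refine prod_congr rfl fun i hi => ?_
    rw [mem_Ico] at hi
    rw [h_above_corner p hp hi.1 hi.2.le hr]
    ring
  rw [H, if_neg (by omega), if_pos rfl, Icc_sub_one_eq_Ico le_rfl, Icc_sub_one_eq_Ico (by omega),
    h1, h2]
  -- The extra product in the weight raises the coefficient of the second product from `-1` to `2
  -- λ_r - 2`.
  linear_combination h0

theorem mul_weight_of_lt (hp : p.parts.Nodup) {m r : ℕ} (hm : 1 ≤ m) (hr : r ∈ cornerRows p)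
    (hmr : m + 2 ≤ r) :
    (2 * (part p r : ℤ) - 1) * H p r (part p r + r - 1) m =
      2 * part p r * (part p (m + 1) - part p r + 1) * (part p 1 + part p r - 1) *
          ((∏ i ∈ Ico 2 (m + 1), ((part p i : ℤ) + part p r - 1)) *
            ∏ i ∈ Ico 2 (m + 1), ((part p i : ℤ) - part p r + 1)) +
        (2 * (part p r : ℤ) - 2) * (part p (m + 1) + part p r) * (part p 1 - part p r) *
          ((∏ i ∈ Ico 2 (m + 1), ((part p i : ℤ) + part p r)) *
            ∏ i ∈ Ico 2 (m + 1), ((part p i : ℤ) - part p r)) := by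
  have hr' := (mem_cornerRows p).mp hr
  have hx : ∀ i, 1 ≤ i → i < r → h p i (r - 1) = part p i + part p r := fun i h1 h2 =>
    h_left p hp h1 (by omega) hr'.2.1
  have hy : ∀ i, 1 ≤ i → i < r → h p i (part p r + r - 1) = part p i - part p r + 1 :=
    fun i h1 h2 => h_above_corner p hp h1 (by omega) hr
  have h0 := mul_snakeSum p hp hr hm (by omega)
  have h1 : ∏ i ∈ Ico 2 (m + 1), h p i (r - 1) =
      ∏ i ∈ Ico 2 (m + 1), ((part p i : ℤ) + part p r) :=
    prod_congr rfl fun i hi => by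
      rw [mem_Ico] at hi
      exact hx i (by omega) (by omega)
  have h2 : ∏ i ∈ Ico 2 (m + 1), h p i (part p r + r - 1) =
      ∏ i ∈ Ico 2 (m + 1), ((part p i : ℤ) - part p r + 1) :=
    prod_congr rfl fun i hi => by
      rw [mem_Ico] at hi
      exact hy i (by omega) (by omega)
  have h3 : ∏ i ∈ Icc 1 m, (h p i (part p r + r - 1) - 1) =
      (part p 1 - part p r) * ∏ i ∈ Ico 2 (m + 1), ((part p i : ℤ) - part p r) := by
    rw [← prod_eq_prod_Ico_succ_bot (show 1 < m + 1 by omega)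
      fun i => (part p i : ℤ) - part p r]
    refine prod_congr (Icc_sub_one_eq_Ico le_rfl (m + 1)) fun i hi => ?_
    rw [mem_Ico] at hi
    rw [hy i (by omega) (by omega)]
    ring
  have h4 : ∏ i ∈ Icc 1 m, (h p i (r - 1) - 1) = (part p 1 + part p r - 1) *
      ∏ i ∈ Ico 2 (m + 1), ((part p i : ℤ) + part p r - 1) := by
    rw [← prod_eq_prod_Ico_succ_bot (show 1 < m + 1 by omega)
      fun i => (part p i : ℤ) + part p r - 1]
    refine prod_congr (Icc_sub_one_eq_Ico le_rfl (m + 1)) fun i hi => ?_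
    rw [mem_Ico] at hi
    rw [hx i (by omega) (by omega)]
  have h5 : ∀ f : ℕ → ℤ, ∏ i ∈ Icc 2 m, f i = ∏ i ∈ Ico 2 (m + 1), f i := fun f =>
    prod_congr (Icc_sub_one_eq_Ico (by omega) (m + 1)) fun _ _ => rfl
  rw [H, if_neg (by omega), if_neg (by omega), h5, h5, snakeSumFull_eq,
    snakeTotalFull_eq _ _ hm, ← snakeSum_eq, h1, h2, h3, h4, hx (m + 1) (by omega) (by omega),
    hy (m + 1) (by omega) (by omega)]
  -- By `snakeTotalFull_eq` the two snake sums together contain the shorter one `1 + (h_{m+1,r-1} -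
  -- 1) = λ_{m+1} + λ_r` times.
  linear_combination ((part p (m + 1) : ℤ) + part p r) * h0

/-! ### Matching each corner's weight with its Lagrange terms. -/

/-- The product of `h - 1` over the squares excluded in `unshadedProd`. -/
def shadedProd (r s : ℕ) : ℤ :=
  (∏ i ∈ Ico 1 r, (h p i (r - 1) - 1)) * (∏ i ∈ Ico 1 r, (h p i s - 1)) *
    ∏ j ∈ Ico r s, (h p r j - 1)

/-- The weight of a corner together with the three trailing products. -/
def fullWeight (r s m : ℕ) : ℤ :=
  H p r s m * (∏ i ∈ Ico (m + 2) r, h p i s) * (∏ j ∈ Ico (max r (m + 1)) s, h p r j) *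
    ∏ i ∈ Ico (m + 2) r, h p i (r - 1)

/-- The parts as rational numbers. -/
def ratPart (i : ℕ) : ℚ := part p i

theorem ratPart_lt (hp : p.parts.Nodup) {i j : ℕ} (hi : 1 ≤ i) (hij : i < j) (hj : j ≤ len p) :
    ratPart p j < ratPart p i :=
  Nat.cast_lt.mpr (part_lt_part p hp hi hij hj)

theorem one_le_ratPart {i : ℕ} (hi : 1 ≤ i) (hl : i ≤ len p) : 1 ≤ ratPart p i :=
  Nat.one_le_cast.mpr (part_pos p hi hl)

theorem shadedProd_eq (hp : p.parts.Nodup) {r : ℕ} (hr : r ∈ cornerRows p) :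
    (shadedProd p r (part p r + r - 1) : ℚ) =
      (∏ i ∈ Ico 1 r, (ratPart p r + ratPart p i - 1)) *
        (∏ i ∈ Ico 1 r, (ratPart p i - ratPart p r)) *
        ∏ j ∈ Ico r (part p r + r - 1), ((h p r j : ℚ) - 1) := by
  have hr' := (mem_cornerRows p).mp hr
  rw [shadedProd]
  push_cast
  congr 2 <;> refine prod_congr rfl fun i hi => ?_ <;> rw [mem_Ico] at hi
  · rw [h_left p hp hi.1 hi.2 hr'.2.1]
    simp only [ratPart]; push_cast; ring
  · rw [h_above_corner p hp hi.1 hi.2.le hr]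
    simp only [ratPart]; push_cast; ring

theorem prod_ratPart_sub_ne_zero (hp : p.parts.Nodup) {r a b : ℕ} (ha : r < a) (hr : 1 ≤ r)
    (hb : b ≤ len p + 1) : ∏ i ∈ Ico a b, (ratPart p r - ratPart p i) ≠ 0 := by
  refine prod_ne_zero_iff.mpr fun i hi => ?_
  rw [mem_Ico] at hi
  have := ratPart_lt p hp hr (show r < i by omega) (by omega)
  linarith

theorem prod_sub_ratPart_ne_zero (hp : p.parts.Nodup) {r a b : ℕ} (ha : 1 ≤ a) (hb : b ≤ r)
    (hr : r ≤ len p) : ∏ i ∈ Ico a b, (ratPart p i - ratPart p r) ≠ 0 := by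
  refine prod_ne_zero_iff.mpr fun i hi => ?_
  rw [mem_Ico] at hi
  have := ratPart_lt p hp (show 1 ≤ i by omega) (show i < r by omega) (by omega)
  linarith

theorem prod_ratPart_add_ne_zero {r a b : ℕ} (hr : 1 ≤ r) (hrl : r ≤ len p) (ha : 1 ≤ a)
    (hb : b ≤ len p + 1) : ∏ i ∈ Ico a b, (ratPart p r + ratPart p i - 1) ≠ 0 := by
  refine prod_ne_zero_iff.mpr fun i hi => ?_
  rw [mem_Ico] at hi
  have := one_le_ratPart p (i := i) (by omega) (by omega)
  have := one_le_ratPart p hr hrl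
  linarith

theorem rat_h_above (hp : p.parts.Nodup) {r a b : ℕ} (ha : 1 ≤ a) (hb : b ≤ r + 1)
    (hr : r ∈ cornerRows p) :
    ∏ i ∈ Ico a b, (h p i (part p r + r - 1) : ℚ) =
      ∏ i ∈ Ico a b, (ratPart p i - ratPart p r + 1) := by
  refine prod_congr rfl fun i hi => ?_
  rw [mem_Ico] at hi
  rw [h_above_corner p hp (by omega) (by omega) hr]
  simp only [ratPart]; push_cast; ring

theorem rat_h_left (hp : p.parts.Nodup) {r a b : ℕ} (ha : 1 ≤ a) (hb : b ≤ r)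
    (hr : r ∈ cornerRows p) :
    ∏ i ∈ Ico a b, (h p i (r - 1) : ℚ) = ∏ i ∈ Ico a b, (ratPart p r + ratPart p i) := by
  refine prod_congr rfl fun i hi => ?_
  rw [mem_Ico] at hi
  rw [h_left p hp (by omega) (by omega) ((mem_cornerRows p).mp hr).2.1]
  simp only [ratPart]; push_cast; ring

theorem fullWeight_of_le_eq (hp : p.parts.Nodup) {r m : ℕ} (hr : r ∈ cornerRows p)
    (hrm : r ≤ m) : (fullWeight p r (part p r + r - 1) m : ℚ) =
      (∏ i ∈ Ico 1 r, (ratPart p r + ratPart p i - 1)) *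
        (∏ j ∈ Ico r m, ((h p r j : ℚ) - 1)) *
        (∏ i ∈ Ico 2 r, (ratPart p i - ratPart p r + 1)) *
        ∏ j ∈ Ico (m + 1) (part p r + r - 1 + 1), (h p r j : ℚ) := by
  have hr' := (mem_cornerRows p).mp hr
  rw [← rat_h_above p hp (by omega) (by omega) hr, fullWeight, weight_of_le p hr'.1 hrm,
    Ico_eq_empty (show ¬ m + 2 < r by omega), max_eq_right (by omega), ← prod_row_succ p hp hr]
  push_cast
  rw [prod_empty, prod_empty, mul_one, mul_one]
  congr 3
  refine prod_congr rfl fun i hi => ?_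
  rw [mem_Ico] at hi
  rw [h_left p hp hi.1 hi.2 hr'.2.1]
  simp only [ratPart]; push_cast; ring

theorem fullWeight_of_len_le (hp : p.parts.Nodup) {r m : ℕ} (hr : r ∈ cornerRows p)
    (hm : len p ≤ m) : (fullWeight p r (part p r + r - 1) m : ℚ) =
      shadedProd p r (part p r + r - 1) *
        if r ≤ colLen p m then plainTerm (ratPart p) (colLen p m) r else 0 := by
  have hr' := (mem_cornerRows p).mp hr
  have hpos := part_pos p hr'.1 hr'.2.1
  have hiff := mem_diagram_iff_le_colLen p hp r m
  have hq := colLen_le_len p hp m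
  rw [fullWeight_of_le_eq p hp hr (by omega), shadedProd_eq p hp hr]
  rw [mem_diagram] at hiff
  dsimp only at hiff
  split_ifs with hrq
  · have hms : m ≤ part p r + r - 1 := by omega
    have h0 := prod_row_of_len_le p hp hr hm hms
    have h1 : (∏ j ∈ Ico (m + 1) (part p r + r - 1 + 1), (h p r j : ℚ)) *
        ∏ i ∈ Ico (r + 1) (colLen p m + 1), (ratPart p r - ratPart p i) =
      (∏ j ∈ Ico m (part p r + r - 1), ((h p r j : ℚ) - 1)) *
        ∏ i ∈ Ico (r + 1) (colLen p m + 1), (ratPart p r - ratPart p i - 1) := by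
      simp only [ratPart]
      exact_mod_cast h0
    have n1 := prod_ratPart_sub_ne_zero p hp (r := r) (lt_add_one r) hr'.1
      (show colLen p m + 1 ≤ len p + 1 by omega)
    have n2 := prod_sub_ratPart_ne_zero p hp le_rfl le_rfl hr'.2.1
    rw [plainTerm, ← prod_Ico_consecutive _ (show r ≤ m by omega) hms]
    field_simp
    linear_combination ((∏ i ∈ Ico 1 r, (ratPart p r + ratPart p i - 1)) *
      (∏ j ∈ Ico r m, ((h p r j : ℚ) - 1)) *
        (∏ i ∈ Ico 2 r, (ratPart p i - ratPart p r + 1))) * h1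
  -- Row `r` ends before column `m`, so the product runs over the corner, where `h - 1 = 0`.
  · have : ∏ j ∈ Ico r m, ((h p r j : ℚ) - 1) = 0 := by
      refine prod_eq_zero (i := part p r + r - 1) (mem_Ico.mpr (by omega)) ?_
      rw [h_corner p hp hr]
      norm_num
    rw [this]
    ring

theorem fullWeight_of_le (hp : p.parts.Nodup) {r m : ℕ} (hr : r ∈ cornerRows p)
    (hrm : r ≤ m) (hm : m < len p) : (fullWeight p r (part p r + r - 1) m : ℚ) =
      shadedProd p r (part p r + r - 1) * leftTerm (ratPart p) (len p) m r := by
  have hr' := (mem_cornerRows p).mp hr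
  have hl := len_le_of_cornerRow p hp hr
  have h0 := prod_row_of_le_len p hp hr hrm hm.le
  have h1 : (∏ j ∈ Ico (m + 1) (part p r + r - 1 + 1), (h p r j : ℚ)) *
        (∏ i ∈ Ico (m + 1) (len p + 1), (ratPart p r + ratPart p i - 1)) *
        ∏ i ∈ Ico (r + 1) (len p + 1), (ratPart p r - ratPart p i) =
      (∏ j ∈ Ico m (part p r + r - 1), ((h p r j : ℚ) - 1)) *
        (ratPart p r * ∏ i ∈ Ico (m + 2) (len p + 1), (ratPart p r + ratPart p i)) *
        ∏ i ∈ Ico (r + 1) (len p + 1), (ratPart p r - ratPart p i - 1) := by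
    rw [prod_Ico_succ_top (show m + 2 ≤ len p + 1 by omega),
      part_eq_zero p (i := len p + 1) (by omega), Nat.cast_zero, add_zero,
      mul_comm _ (part p r : ℤ)] at h0
    simp only [ratPart]
    exact_mod_cast h0
  have n1 := prod_ratPart_sub_ne_zero p hp (r := r) (lt_add_one r) hr'.1 le_rfl
  have n2 := prod_sub_ratPart_ne_zero p hp le_rfl le_rfl hr'.2.1
  have n3 := prod_ratPart_add_ne_zero p hr'.1 hr'.2.1 (show 1 ≤ m + 1 by omega) le_rfl
  rw [fullWeight_of_le_eq p hp hr hrm, shadedProd_eq p hp hr, leftTerm, plainTerm,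
    ← prod_Ico_consecutive _ hrm (show m ≤ part p r + r - 1 by omega)]
  field_simp
  linear_combination ((∏ i ∈ Ico 1 r, (ratPart p r + ratPart p i - 1)) *
      (∏ j ∈ Ico r m, ((h p r j : ℚ) - 1)) *
        (∏ i ∈ Ico 2 r, (ratPart p i - ratPart p r + 1))) * h1

theorem rat_prod_whole_row (hp : p.parts.Nodup) {r : ℕ} (hr : r ∈ cornerRows p) :
    (∏ j ∈ Ico r (part p r + r - 1), (h p r j : ℚ)) *
        (∏ i ∈ Ico (r + 1) (len p + 1), (ratPart p r + ratPart p i - 1)) *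
        ∏ i ∈ Ico (r + 1) (len p + 1), (ratPart p r - ratPart p i) =
      (∏ j ∈ Ico r (part p r + r - 1), ((h p r j : ℚ) - 1)) *
        (ratPart p r * ∏ i ∈ Ico (r + 1) (len p + 1), (ratPart p r + ratPart p i)) *
        ∏ i ∈ Ico (r + 1) (len p + 1), (ratPart p r - ratPart p i - 1) := by
  have h0 := prod_whole_row p hp hr
  simp only [ratPart]
  exact_mod_cast h0

theorem prod_neg_sub (s : Finset ℕ) (a : ℕ → ℚ) (t : ℚ) :
    ∏ i ∈ s, (a i - t) = (-1) ^ s.card * ∏ i ∈ s, (t - a i) := by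
  rw [← prod_neg]
  exact prod_congr rfl fun i _ => by ring

theorem prod_neg_sub_sub_one (s : Finset ℕ) (a : ℕ → ℚ) (t : ℚ) :
    ∏ i ∈ s, (a i - t + 1) = (-1) ^ s.card * ∏ i ∈ s, (t - a i - 1) := by
  rw [← prod_neg]
  exact prod_congr rfl fun i _ => by ring

/-- The algebra behind `fullWeight_succ`. -/
theorem weight_succ_algebra {t P Y α β γ δ A B B' E G V ε W : ℚ} (hP : P ≠ 0) (hY : Y ≠ 0)
    (hα : α ≠ 0) (hδ : δ ≠ 0) (hA : A ≠ 0) (hB : B ≠ 0) (hε : ε ≠ 0) (ht : 2 * t - 1 ≠ 0)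
    (hV : V * A * B = G * (t * E) * B')
    (hW : (2 * t - 1) * W = P * (α * β) + (2 * t - 2) * Y * (γ * δ)) :
    W * V = (P * α) * (Y * δ) * G * (β / (Y * δ) * (B' / B) * (t * E / ((t + t - 1) * A)) +
      (t - 1) * (γ * (t + t) * E) * (ε * B') /
        ((P * α) * (t + t - 1) * A * (ε * B))) := by
  have ht' : t + t - 1 ≠ 0 := by rwa [← two_mul]
  obtain rfl : W = (P * (α * β) + (2 * t - 2) * Y * (γ * δ)) / (2 * t - 1) := by
    rw [eq_div_iff ht, ← hW]; ring
  obtain rfl : V = G * (t * E) * B' / (A * B) := by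
    rw [eq_div_iff (mul_ne_zero hA hB), ← hV]; ring
  rw [← two_mul]
  field_simp

/-- The algebra behind `fullWeight_of_lt`. -/
theorem weight_of_lt_algebra {t b P Y α β γ δ A B B' E G V ε W ξ ξ' η η' : ℚ} (hP : P ≠ 0)
    (hY : Y ≠ 0) (hα : α ≠ 0) (hδ : δ ≠ 0) (hA : A ≠ 0) (hB : B ≠ 0) (hε : ε ≠ 0)
    (ht : 2 * t - 1 ≠ 0) (hξ : ξ' ≠ 0) (hη : η' ≠ 0) (hb : t + b - 1 ≠ 0) (hb' : b - t ≠ 0)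
    (hV : V * A * B = G * (t * E) * B')
    (hW : (2 * t - 1) * W = 2 * t * (b - t + 1) * P * (α * β) +
      (2 * t - 2) * (b + t) * Y * (γ * δ)) :
    W * η * V * ξ = (P * (α * (t + b - 1) * ξ')) * (Y * (δ * (b - t) * η')) * G *
      ((β * (b - t + 1) * η) / (Y * (δ * (b - t) * η')) * (B' / B) *
        (t * (ξ * (t + t) * E) / ((t + b - 1) * (ξ' * (t + t - 1) * A))) +
      (t - 1) * (γ * (t + b) * (ξ * (t + t) * E)) * (η * 1 * (ε * B')) /
        ((P * (α * (t + b - 1) * (ξ' * (t + t - 1) * A))) * ((b - t) * η' * (ε * B)))) := by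
  have ht' : t + t - 1 ≠ 0 := by rwa [← two_mul]
  obtain rfl : W = (2 * t * (b - t + 1) * P * (α * β) +
      (2 * t - 2) * (b + t) * Y * (γ * δ)) / (2 * t - 1) := by
    rw [eq_div_iff ht, ← hW]; ring
  obtain rfl : V = G * (t * E) * B' / (A * B) := by
    rw [eq_div_iff (mul_ne_zero hA hB), ← hV]; ring
  rw [← two_mul]
  field_simp
  ring

theorem prod_Ico_one_eq {r : ℕ} (hr : 1 < r) (f : ℕ → ℚ) :
    ∏ i ∈ Ico 1 r, f i = f 1 * ∏ i ∈ Ico 2 r, f i :=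
  prod_eq_prod_Ico_succ_bot hr f

theorem fullWeight_succ (hp : p.parts.Nodup) {m : ℕ} (hm : 1 ≤ m)
    (hr : m + 1 ∈ cornerRows p) :
    (fullWeight p (m + 1) (part p (m + 1) + (m + 1) - 1) m : ℚ) =
      shadedProd p (m + 1) (part p (m + 1) + (m + 1) - 1) *
        (leftTerm (ratPart p) (len p) m (m + 1) + rightTerm (ratPart p) (len p) m (m + 1)) := by
  have hr' := (mem_cornerRows p).mp hr
  have hV := rat_prod_whole_row p hp hr
  have hW := congrArg (Int.cast : ℤ → ℚ) (mul_weight_succ p hp hm hr)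
  push_cast at hW
  have nB := prod_ratPart_sub_ne_zero p hp (r := m + 1) (lt_add_one _) hr'.1 le_rfl
  have nδ := prod_sub_ratPart_ne_zero p hp (r := m + 1) (show 1 ≤ 2 by omega) le_rfl hr'.2.1
  have nα := prod_ratPart_add_ne_zero p hr'.1 hr'.2.1 (a := 2) (b := m + 1) (by omega) (by omega)
  have nA := prod_ratPart_add_ne_zero p hr'.1 hr'.2.1 (a := m + 1 + 1) (by omega) le_rfl
  have i1 := ratPart_lt p hp le_rfl (show 1 < m + 1 by omega) hr'.2.1
  have i2 := one_le_ratPart p hr'.1 hr'.2.1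
  have c1 : ∏ i ∈ Ico 2 (m + 1), ((part p i : ℚ) + part p (m + 1) - 1) =
      ∏ i ∈ Ico 2 (m + 1), (ratPart p (m + 1) + ratPart p i - 1) :=
    prod_congr rfl fun i _ => by simp only [ratPart]; ring
  have c2 : ∏ i ∈ Ico 2 (m + 1), ((part p i : ℚ) + part p (m + 1)) =
      ∏ i ∈ Ico 2 (m + 1), (ratPart p (m + 1) + ratPart p i) :=
    prod_congr rfl fun i _ => by simp only [ratPart]; ring
  rw [c1, c2] at hW
  rw [fullWeight, Ico_eq_empty (show ¬ m + 2 < m + 1 by omega), max_self, prod_empty, prod_empty,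
    mul_one, mul_one, shadedProd_eq p hp hr, leftTerm, plainTerm, rightTerm,
    prod_eq_prod_Ico_succ_bot (show m + 1 < len p + 1 by omega),
    prod_erase_Ico le_rfl hr'.2.1, Ico_self, prod_empty, one_mul,
    prod_Ico_eq_mul_mul (show 2 ≤ m + 1 by omega) hr'.2.1,
    prod_Ico_eq_mul_mul (show 1 ≤ m + 1 by omega) hr'.2.1,
    prod_Ico_one_eq (show 1 < m + 1 by omega), prod_Ico_one_eq (show 1 < m + 1 by omega),
    prod_neg_sub (Ico (m + 1 + 1) _) (ratPart p), prod_neg_sub_sub_one (Ico (m + 1 + 1) _)]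
  push_cast
  refine weight_succ_algebra ?_ ?_ nα nδ nA nB (pow_ne_zero _ (by norm_num)) ?_ hV ?_
  · linarith
  · linarith
  · linarith
  · simp only [ratPart] at hW ⊢
    linear_combination hW

theorem fullWeight_of_lt (hp : p.parts.Nodup) {m r : ℕ} (hm : 1 ≤ m)
    (hr : r ∈ cornerRows p) (hmr : m + 2 ≤ r) :
    (fullWeight p r (part p r + r - 1) m : ℚ) =
      shadedProd p r (part p r + r - 1) *
        (leftTerm (ratPart p) (len p) m r + rightTerm (ratPart p) (len p) m r) := by
  have hr' := (mem_cornerRows p).mp hr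
  have hV := rat_prod_whole_row p hp hr
  have hW := congrArg (Int.cast : ℤ → ℚ) (mul_weight_of_lt p hp hm hr hmr)
  push_cast at hW
  have nB := prod_ratPart_sub_ne_zero p hp (r := r) (lt_add_one _) hr'.1 le_rfl
  have nδ := prod_sub_ratPart_ne_zero p hp (r := r) (a := 2) (b := m + 1) (by omega) (by omega)
    hr'.2.1
  have nη := prod_sub_ratPart_ne_zero p hp (r := r) (a := m + 2) (by omega) le_rfl hr'.2.1
  have nα := prod_ratPart_add_ne_zero p hr'.1 hr'.2.1 (a := 2) (b := m + 1) (by omega) (by omega)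
  have nξ := prod_ratPart_add_ne_zero p hr'.1 hr'.2.1 (a := m + 2) (b := r) (by omega) (by omega)
  have nA := prod_ratPart_add_ne_zero p hr'.1 hr'.2.1 (a := r + 1) (by omega) le_rfl
  have i1 := ratPart_lt p hp le_rfl (show 1 < r by omega) hr'.2.1
  have i2 := one_le_ratPart p hr'.1 hr'.2.1
  have i3 := ratPart_lt p hp (show 1 ≤ m + 1 by omega) (show m + 1 < r by omega) hr'.2.1
  have c1 : ∏ i ∈ Ico 2 (m + 1), ((part p i : ℚ) + part p r - 1) =
      ∏ i ∈ Ico 2 (m + 1), (ratPart p r + ratPart p i - 1) :=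
    prod_congr rfl fun i _ => by simp only [ratPart]; ring
  have c2 : ∏ i ∈ Ico 2 (m + 1), ((part p i : ℚ) + part p r) =
      ∏ i ∈ Ico 2 (m + 1), (ratPart p r + ratPart p i) :=
    prod_congr rfl fun i _ => by simp only [ratPart]; ring
  rw [c1, c2] at hW
  have split : ∀ f : ℕ → ℚ, ∏ i ∈ Ico 2 r, f i =
      (∏ i ∈ Ico 2 (m + 1), f i) * f (m + 1) * ∏ i ∈ Ico (m + 2) r, f i := fun f => by
    obtain ⟨k, rfl⟩ : ∃ k, r = k + 1 := ⟨r - 1, by omega⟩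
    exact prod_Ico_eq_mul_mul (by omega) (by omega) f
  have s1 : ∀ f : ℕ → ℚ, ∏ i ∈ Ico 1 r, f i =
      f 1 * ((∏ i ∈ Ico 2 (m + 1), f i) * f (m + 1) * ∏ i ∈ Ico (m + 2) r, f i) := fun f => by
    rw [prod_Ico_one_eq (by omega), split]
  have s2 : ∀ f : ℕ → ℚ, ∏ i ∈ Ico (m + 2) (len p + 1), f i =
      (∏ i ∈ Ico (m + 2) r, f i) * f r * ∏ i ∈ Ico (r + 1) (len p + 1), f i := fun f =>
    prod_Ico_eq_mul_mul (by omega) hr'.2.1 f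
  have s3 : ∀ f : ℕ → ℚ, ∏ i ∈ Ico (m + 1) (len p + 1), f i = f (m + 1) *
      ((∏ i ∈ Ico (m + 2) r, f i) * f r * ∏ i ∈ Ico (r + 1) (len p + 1), f i) := fun f => by
    rw [prod_eq_prod_Ico_succ_bot (by omega), s2]
  have s4 : ∀ f : ℕ → ℚ, ∏ i ∈ Ico 2 (len p + 1), f i = (∏ i ∈ Ico 2 (m + 1), f i) * f (m + 1) *
      ((∏ i ∈ Ico (m + 2) r, f i) * f r * ∏ i ∈ Ico (r + 1) (len p + 1), f i) := fun f => by
    rw [prod_Ico_eq_mul_mul (show 2 ≤ m + 1 by omega) (by omega), s2]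
  have s5 : ∀ f : ℕ → ℚ, ∏ i ∈ Ico 1 (len p + 1), f i = f 1 * ((∏ i ∈ Ico 2 (m + 1), f i) *
      f (m + 1) * ((∏ i ∈ Ico (m + 2) r, f i) * f r *
        ∏ i ∈ Ico (r + 1) (len p + 1), f i)) := fun f => by
    rw [prod_Ico_one_eq (by omega), s4]
  have s6 : ∀ f : ℕ → ℚ, ∏ i ∈ (Ico (m + 1) (len p + 1)).erase r, f i =
      f (m + 1) * (∏ i ∈ Ico (m + 2) r, f i) * ∏ i ∈ Ico (r + 1) (len p + 1), f i := fun f => by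
    rw [prod_erase_Ico (by omega) hr'.2.1, prod_eq_prod_Ico_succ_bot (by omega)]
  rw [fullWeight, max_eq_left (by omega), shadedProd_eq p hp hr, leftTerm, plainTerm, rightTerm]
  push_cast
  rw [rat_h_above p hp (by omega) (by omega) hr, rat_h_left p hp (by omega) le_rfl hr]
  simp only [split, s1, s2, s3, s4, s5, s6]
  -- Reversing the differences beyond row `r` gives the same sign `ε` in numerator and denominator
  -- of `rightTerm`; the numerator's factor at `i = r` is 1.
  rw [prod_neg_sub (Ico (r + 1) _) (ratPart p), prod_neg_sub_sub_one (Ico (r + 1) _), sub_self, zero_add]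
  refine weight_of_lt_algebra ?_ ?_ nα nδ nA nB (pow_ne_zero _ (by norm_num)) ?_ nξ nη ?_ ?_ hV ?_
  · linarith
  · linarith
  · linarith
  · linarith
  · linarith
  · simp only [ratPart] at hW ⊢
    linear_combination hW

/-! ### Vanishing for rows without a corner, and summation. -/

theorem injOn_ratPart (hp : p.parts.Nodup) {q : ℕ} (hq : q ≤ len p) :
    Set.InjOn (ratPart p) (Ico 1 (q + 1)) := by
  intro i hi j hj hij
  rw [mem_coe, mem_Ico] at hi hj
  rcases lt_trichotomy i j with h | h | h
  · exact absurd hij (ratPart_lt p hp hi.1 h (by omega)).ne'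
  · exact h
  · exact absurd hij (ratPart_lt p hp hj.1 h (by omega)).ne

theorem ratPart_succ_of_notMem (hp : p.parts.Nodup) {r : ℕ} (hr : 1 ≤ r) (hrl : r ≤ len p)
    (hc : r ∉ cornerRows p) : r < len p ∧ ratPart p r = ratPart p (r + 1) + 1 := by
  rw [mem_cornerRows] at hc
  have hl : r < len p := by omega
  have := part_lt_part p hp hr (lt_add_one r) (by omega)
  refine ⟨hl, ?_⟩
  simp only [ratPart]
  norm_cast
  omega

theorem plainTerm_eq_zero {a : ℕ → ℚ} {q r : ℕ} (hr : r < q) (ha : a r = a (r + 1) + 1) :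
    plainTerm a q r = 0 := by
  rw [plainTerm, prod_eq_zero (s := Ico (r + 1) (q + 1)) (f := fun i => a r - a i - 1)
    (mem_Ico.mpr ⟨le_rfl, by omega⟩) (by rw [ha]; ring), zero_div, mul_zero]

theorem rightTerm_eq_zero {a : ℕ → ℚ} {l m r : ℕ} (hm : m < r) (hr : r < l)
    (ha : a r = a (r + 1) + 1) : rightTerm a l m r = 0 := by
  rw [rightTerm, prod_eq_zero (s := Ico (m + 2) (l + 1)) (f := fun i => a i - a r + 1)
    (i := r + 1) (mem_Ico.mpr ⟨by omega, by omega⟩) (by rw [ha]; ring), mul_zero, zero_div]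

/-- The fraction of the hook product contributed by the corner in row `r`. -/
def cornerRatio (m r : ℕ) : ℚ :=
  if m < len p then
    leftTerm (ratPart p) (len p) m r + if m < r then rightTerm (ratPart p) (len p) m r else 0
  else if r ≤ colLen p m then plainTerm (ratPart p) (colLen p m) r else 0

theorem fullWeight_eq (hp : p.parts.Nodup) {m r : ℕ} (hm : 1 ≤ m) (hr : r ∈ cornerRows p) :
    (fullWeight p r (part p r + r - 1) m : ℚ) =
      shadedProd p r (part p r + r - 1) * cornerRatio p m r := by
  rw [cornerRatio]
  split_ifs with h1 h2 h3
  · rcases (show m + 1 = r ∨ m + 2 ≤ r by omega) with rfl | h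
    · exact fullWeight_succ p hp hm hr
    · exact fullWeight_of_lt p hp hm hr h
  · rw [add_zero, fullWeight_of_le p hp hr (by omega) h1]
  · rw [fullWeight_of_len_le p hp hr (by omega), if_pos h3]
  · rw [fullWeight_of_len_le p hp hr (by omega), if_neg h3]

theorem cornerRatio_eq_zero (hp : p.parts.Nodup) {m r : ℕ} (hr : 1 ≤ r) (hrl : r ≤ len p)
    (hc : r ∉ cornerRows p) : cornerRatio p m r = 0 := by
  obtain ⟨h1, h2⟩ := ratPart_succ_of_notMem p hp hr hrl hc
  rw [cornerRatio]
  split_ifs with h3 h4 h5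
  · rw [leftTerm, plainTerm_eq_zero h1 h2, rightTerm_eq_zero h4 h1 h2]
    ring
  · rw [leftTerm, plainTerm_eq_zero h1 h2]
    ring
  · refine plainTerm_eq_zero ?_ h2
    -- Rows `r` and `r + 1` end in the same column, so row `r + 1` also meets column `m`, which
    -- gives `r < colLen p m`.
    have h6 := (mem_diagram_iff_le_colLen p hp r m).mpr ⟨hr, h5⟩
    refine ((mem_diagram_iff_le_colLen p hp (r + 1) m).mp ?_).2
    rw [mem_diagram] at h6 ⊢
    simp only [ratPart] at h2
    norm_cast at h2
    dsimp only at h6 ⊢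
    omega
  · rfl

theorem sum_cornerRatio (hp : p.parts.Nodup) {m : ℕ} (hm : 1 ≤ m) (hm1 : m ≤ part p 1) :
    ∑ r ∈ cornerRows p, cornerRatio p m r = 1 := by
  have hlen : 1 ≤ len p := by
    by_contra hc
    have := part_eq_zero p (i := 1) (by omega)
    omega
  have hsub : cornerRows p ⊆ Ico 1 (len p + 1) := fun r hr => by
    rw [mem_cornerRows] at hr
    rw [mem_Ico]
    omega
  -- Extending the sum to all rows supplies the full set of nodes.
  rw [sum_subset hsub fun r hr hc => by
    rw [mem_Ico] at hr
    exact cornerRatio_eq_zero p hp hr.1 (by omega) hc]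
  simp only [cornerRatio]
  by_cases h : m < len p
  · simp only [if_pos h]
    rw [sum_add_distrib, ← sum_filter]
    have hf : (Ico 1 (len p + 1)).filter (fun r => m < r) = Ico (m + 1) (len p + 1) := by
      ext r
      rw [mem_filter, mem_Ico, mem_Ico]
      omega
    rw [hf]
    exact sum_leftTerm_add_sum_rightTerm _ h (injOn_ratPart p hp le_rfl) fun i hi => by
      rw [mem_Ico] at hi
      exact one_le_ratPart p hi.1 (by omega)
  · simp only [if_neg h]
    have hq := colLen_le_len p hp m
    rw [← sum_filter]
    have hf : (Ico 1 (len p + 1)).filter (fun r => r ≤ colLen p m) = Ico 1 (colLen p m + 1) := by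
      ext r
      rw [mem_filter, mem_Ico, mem_Ico]
      omega
    rw [hf]
    -- Since `m ≤ λ_1`, the square `(1, m)` is in the diagram and column `m` is nonempty.
    exact sum_plainTerm _ ((mem_diagram_iff_le_colLen p hp 1 m).mp
      ((mem_diagram p _).mpr ⟨le_rfl, hlen, hm, by dsimp only; omega⟩)).2 (injOn_ratPart p hp hq)

theorem prod_eq_sum_fullWeight (hp : p.parts.Nodup) {m : ℕ} (hm : 1 ≤ m) (hm1 : m ≤ part p 1) :
    ∏ z ∈ diagram p \ corners p, (h p z.1 z.2 - 1) =
      ∑ c ∈ corners p, unshadedProd p c.1 c.2 * fullWeight p c.1 c.2 m := by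
  have key : ∀ c ∈ corners p, ((unshadedProd p c.1 c.2 * fullWeight p c.1 c.2 m : ℤ) : ℚ) =
      (∏ z ∈ diagram p \ corners p, (h p z.1 z.2 - 1) : ℤ) * cornerRatio p m c.1 := by
    rintro ⟨r, s⟩ hc
    obtain ⟨hr, hs⟩ := (mem_corners_iff p hp r s).mp hc
    have h0 : ∏ z ∈ diagram p \ corners p, (h p z.1 z.2 - 1) =
        unshadedProd p r s * shadedProd p r s := prod_eq_unshadedProd_mul p hp hc
    rw [h0]
    subst hs
    dsimp only
    push_cast
    rw [fullWeight_eq p hp hm hr]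
    ring
  apply Int.cast_injective (α := ℚ)
  rw [Int.cast_sum, sum_congr rfl key, ← mul_sum, corners_eq_image p hp, sum_image,
    sum_cornerRatio p hp hm hm1, mul_one]
  intro x _ y _ hxy
  exact (Prod.mk.inj hxy).1

/-! ### The case `m = 1`. -/

theorem weight_one (hp : p.parts.Nodup) {r s : ℕ} (hc : (r, s) ∈ corners p) :
    H p r s 1 = h p 1 s * h p 2 (r - 1) + (h p 1 (r - 1) - 1) * (h p 2 s - 1) := by
  obtain ⟨hr, hs⟩ := (mem_corners_iff p hp r s).mp hc
  have hr' := (mem_cornerRows p).mp hr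
  -- For `r = 1` and `r = 2` the uniform formula refers to squares left of the diagonal, where the
  -- convention `h = 1` makes it agree with the weight.
  have hout : ∀ i j : ℕ, j < i → h p i j = 1 := fun i j hij => by
    rw [h, if_neg]
    rw [mem_diagram]
    dsimp only
    omega
  rcases (show r = 1 ∨ r = 2 ∨ 1 + 2 ≤ r by omega) with rfl | rfl | h3
  · have : h p 1 s = 1 := by rw [hs]; exact h_corner p hp hr
    rw [weight_of_le p le_rfl le_rfl, hout 2 (1 - 1) (by omega), hout 1 (1 - 1) (by omega), this]
    simp
  · have : h p 2 s = 1 := by rw [hs]; exact h_corner p hp hr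
    rw [H, if_neg (by omega), if_pos rfl, snakeSum_eq, snakeTotal_one, this,
      hout 2 (2 - 1) (by omega)]
    simp
  · rw [H, if_neg (by omega), if_neg (by omega), snakeSumFull_eq, snakeTotalFull_eq _ _ le_rfl,
      snakeSum_eq, snakeTotal_one]
    simp
    ring

end ShiftedHook

theorem mainTheorem7 {n : ℕ} (p : n.Partition) (hp : p.parts.Nodup) :
    (∀ m : ℕ, 1 ≤ m → m ≤ ShiftedHook.part p 1 →
      ∏ z ∈ ShiftedHook.diagram p \ ShiftedHook.corners p, (ShiftedHook.h p z.1 z.2 - 1) =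
        ∑ c ∈ ShiftedHook.corners p,
          ShiftedHook.H p c.1 c.2 m * ShiftedHook.unshadedProd p c.1 c.2 *
            (∏ i ∈ Finset.Icc (m + 2) (c.1 - 1), ShiftedHook.h p i c.2) *
            (∏ j ∈ Finset.Icc (max c.1 (m + 1)) (c.2 - 1), ShiftedHook.h p c.1 j) *
            ∏ i ∈ Finset.Icc (m + 2) (c.1 - 1), ShiftedHook.h p i (c.1 - 1)) ∧
    (∀ r s : ℕ, (r, s) ∈ ShiftedHook.corners p →
      ShiftedHook.H p r s 1 * ShiftedHook.unshadedProd p r s *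
          (∏ i ∈ Finset.Icc (1 + 2) (r - 1), ShiftedHook.h p i s) *
          (∏ j ∈ Finset.Icc (max r (1 + 1)) (s - 1), ShiftedHook.h p r j) *
          (∏ i ∈ Finset.Icc (1 + 2) (r - 1), ShiftedHook.h p i (r - 1)) =
        (ShiftedHook.h p 1 s * ShiftedHook.h p 2 (r - 1) +
            (ShiftedHook.h p 1 (r - 1) - 1) * (ShiftedHook.h p 2 s - 1)) *
          ShiftedHook.unshadedProd p r s *
          (∏ i ∈ Finset.Icc 3 (r - 1), ShiftedHook.h p i s) *
          (∏ j ∈ Finset.Icc (max r 2) (s - 1), ShiftedHook.h p r j) *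
          ∏ i ∈ Finset.Icc 3 (r - 1), ShiftedHook.h p i (r - 1)) := by
  refine ⟨fun m hm hm1 => ?_, fun r s hc => ?_⟩
  · rw [ShiftedHook.prod_eq_sum_fullWeight p hp hm hm1]
    refine Finset.sum_congr rfl fun c _ => ?_
    rw [ShiftedHook.fullWeight, ShiftedHook.Icc_sub_one_eq_Ico (by omega),
      ShiftedHook.Icc_sub_one_eq_Ico (le_max_of_le_right (by omega))]
    ring
  · rw [ShiftedHook.weight_one p hp hc]
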